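/- Let $m\ge 1$, $n\ge 0$, and let $q,v_1,\dots,v_m\in\mathbb{C}$ satisfy $q\neq 0$, $q^2\neq 1$ (the latter is needed only if $n\ge 2$), and 1. $1+q^2+\dots+q^{2N}\neq 0$ for all integers $0\le N<n$; 2. $q^{2i}v_j-v_k\neq 0$ for all $j\neq k$ and all integers $-n<i<n$; 3. $v_j\neq 0$ for $j=1,\dots,m$. Let $H(m,1,n)$ be the cyclotomic Hecke algebra: the unital associative $\mathbb{C}$-algebra with generators $\tau$ (present if $n\ge1$), $\sigma_1,\dots,\sigma_{n-1}$ and relations $\sigma_i\sigma_{i+1}\sigma_i=\sigma_{i+1}\sigma_i\sigma_{i+1}$, $\sigma_i\sigma_j=\sigma_j\sigma_i$ for $|i-j|>1$, $\tau\sigma_1\tau\sigma_1=\sigma_1\tau\sigma_1\tau$, $\tau\sigma_i=\sigma_i\tau$ for $i>1$, $\sigma_i^2=(q-q^{-1})\sigma_i+1$, $(\tau-v_1)\cdots(\tau-v_m)=0$. An $m$-partition $\lambda^{(m)}$ of $n$ is an $m$-tuple of Young diagrams with $n$ nodes in total; a standard $m$-tableau $X$ of shape $\lambda^{(m)}$ is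 a filling of its nodes with $1,\dots,n$, each used once, that in every diagram increases along rows and columns. If $i$ lies in line $r$ and column $s$ of the $k$-th diagram, put $c(X|i)=v_kq^{2(s-r)}$. Let $X^{s_i}$ be $X$ with $i$ and $i+1$ exchanged. Let $\mathfrak{T}$ (the smash product of $H(m,1,n)$ with a free algebra) be the algebra generated by $H(m,1,n)$ and one generator $\mathcal{X}$ for each standard $m$-tableau $X$ of each shape of size $n$, with the additional relations $$\Bigl(\sigma_i+\tfrac{(q-q^{-1})c(X|i+1)}{c(X|i)-c(X|i+1)}\Bigr)\mathcal{X}=\mathcal{X}^{s_i}\Bigl(\sigma_i+\tfrac{(q-q^{-1})c(X|i)}{c(X|i+1)-c(X|i)}\Bigr),\qquad (\tau-c(X|1))\,\mathcal{X}=0,$$ where $\mathcal{X}^{s_i}$ is the generator of $X^{s_i}$ if $X^{s_i}$ is standard and $0$ otherwise. Let $|\rangle$ be the vacuum: the generator of the left $\mathfrak{T}$-module induced from the one-dimensional $H(m,1,n)$-module on which $\tau|\rangle=v_1|\rangle$ and $\sigma_i|\rangle=q|\rangle$ for all $i$. Let $V_{\lambda^{(m)}}$ be the $H(m,1,n)$-module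 generated in it by the vectors $\mathcal{X}|\rangle$, $X$ a standard $m$-tableau of shape $\lambda^{(m)}$, and let $V_{\lambda^{(m)}}\hat\otimes V_{\lambda'^{(m)}}$ be the $H(m,1,n)$-module generated in it by the vectors $\mathcal{X}\mathcal{X}'|\rangle$, with $X$, $X'$ standard of shapes $\lambda^{(m)}$, $\lambda'^{(m)}$. **Proposition.** For any two $m$-partitions $\lambda^{(m)}$ and $\lambda'^{(m)}$ of $n$, the vectors $\mathcal{X}|\rangle$ form a basis of the vector space $V_{\lambda^{(m)}}$ and the vectors $\mathcal{X}\mathcal{X}'|\rangle$ form a basis of the vector space $V_{\lambda^{(m)}}\hat\otimes V_{\lambda'^{(m)}}$ (so its underlying space is the tensor product of those of $V_{\lambda^{(m)}}$ and $V_{\lambda'^{(m)}}$), and there is an isomorphism of $H(m,1,n)$-modules $$V_{\lambda^{(m)}}\hat\otimes V_{\lambda'^{(m)}}\;\cong\;\dim(V_{\lambda'^{(m)}})\;V_{\lambda^{(m)}},$$ the direct sum of $\dim(V_{\lambda'^{(m)}})$ copies of $V_{\lambda^{(m)}}$. -/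

import Mathlib

/-!
# Cyclotomic Hecke algebras, the smash product with the free algebra on standard `m`-tableaux,
# and the tensor product of two tableau modules
-/

namespace CyclotomicHecke

noncomputable section

/-! ### Young `m`-diagrams and standard `m`-tableaux -/

/-- An `m`-partition of `n`: an `m`-tuple of Young diagrams with `n` nodes altogether. -/
structure MPartition (m n : ℕ) where
  /-- the `k`-th diagram -/
  diag : Fin m → YoungDiagram
  /-- the total size is `n` -/
  size_eq : ∑ k, (diag k).card = n

variable {m n : ℕ}

/-- The `m`-nodes of an `m`-partition: triples (position, (line, column)), with lines and columns
numbered from `0`. -/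
def MPartition.Node (lam : MPartition m n) : Type :=
  {x : Fin m × ℕ × ℕ // x.2 ∈ lam.diag x.1}

/-- The position of an `m`-node, that is, the index of the diagram containing it. -/
def MPartition.Node.pos {lam : MPartition m n} (x : lam.Node) : Fin m := x.1.1

/-- The line of an `m`-node. -/
def MPartition.Node.row {lam : MPartition m n} (x : lam.Node) : ℕ := x.1.2.1

/-- The column of an `m`-node. -/
def MPartition.Node.col {lam : MPartition m n} (x : lam.Node) : ℕ := x.1.2.2

/-- A filling of the nodes of `lam` with the numbers `1, …, n`, each used once. The number `i + 1`
is represented by `i : Fin n`, and `T i` is the node that carries it. -/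
abbrev Filling (lam : MPartition m n) : Type := Fin n ≃ lam.Node

/-- In every diagram the numbers ascend along rows (to the right) and along columns (down). -/
def Filling.IsStandard {lam : MPartition m n} (T : Filling lam) : Prop :=
  (∀ i j : Fin n, (T i).pos = (T j).pos → (T i).row = (T j).row → (T i).col < (T j).col → i < j) ∧
  (∀ i j : Fin n, (T i).pos = (T j).pos → (T i).col = (T j).col → (T i).row < (T j).row → i < j)

/-- Standard Young `m`-tableaux of shape `lam`. -/
def StdTableau (lam : MPartition m n) : Type := {T : Filling lam // T.IsStandard}

/-- The filling `T^π`, obtained by applying the permutation `π` to the numbers in the nodes. -/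
def Filling.perm {lam : MPartition m n} (T : Filling lam) (π : Equiv.Perm (Fin n)) : Filling lam :=
  π.symm.trans T

/-- The content `v_k q^(2 (column - line))` of the node of `T` carrying a given number. -/
def Filling.content {lam : MPartition m n} (T : Filling lam) (q : ℂ) (v : Fin m → ℂ) (i : Fin n) :
    ℂ :=
  v (T i).pos * q ^ (2 * (((T i).col : ℤ) - ((T i).row : ℤ)))

/-! ### The cyclotomic Hecke algebra `H(m,1,n)` -/

/-- The generators of `H(m,1,n)`: `τ` (present if `n ≥ 1`) and `σ_1, …, σ_{n-1}`.
Here `sigma i` stands for `σ_{i+1}`. -/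
inductive HGen (n : ℕ) : Type
  | tau (h : 0 < n) : HGen n
  | sigma (i : ℕ) (h : i + 1 < n) : HGen n

/-- `τ` in the free algebra. -/
def fTau (h : 0 < n) : FreeAlgebra ℂ (HGen n) := FreeAlgebra.ι ℂ (HGen.tau h)

/-- `σ_{i+1}` in the free algebra. -/
def fSigma (i : ℕ) (h : i + 1 < n) : FreeAlgebra ℂ (HGen n) := FreeAlgebra.ι ℂ (HGen.sigma i h)

/-- The defining relations of `H(m,1,n)` with parameters `q, v_1, …, v_m`. -/
inductive HeckeRel (n : ℕ) (q : ℂ) (v : Fin m → ℂ) :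
    FreeAlgebra ℂ (HGen n) → FreeAlgebra ℂ (HGen n) → Prop
  | braid (i : ℕ) (h : i + 1 + 1 < n) (h' : i + 1 < n) :
      HeckeRel n q v (fSigma i h' * fSigma (i + 1) h * fSigma i h')
        (fSigma (i + 1) h * fSigma i h' * fSigma (i + 1) h)
  | far (i j : ℕ) (hi : i + 1 < n) (hj : j + 1 < n) (hij : i + 1 < j) :
      HeckeRel n q v (fSigma i hi * fSigma j hj) (fSigma j hj * fSigma i hi)
  | tau_braid (h : 0 < n) (h' : 0 + 1 < n) :
      HeckeRel n q v (fTau h * fSigma 0 h' * fTau h * fSigma 0 h')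
        (fSigma 0 h' * fTau h * fSigma 0 h' * fTau h)
  | tau_far (h : 0 < n) (i : ℕ) (hi : i + 1 < n) (hpos : 0 < i) :
      HeckeRel n q v (fTau h * fSigma i hi) (fSigma i hi * fTau h)
  | quadratic (i : ℕ) (hi : i + 1 < n) :
      HeckeRel n q v (fSigma i hi * fSigma i hi) ((q - q⁻¹) • fSigma i hi + 1)
  | cyclotomic (h : 0 < n) :
      HeckeRel n q v (List.ofFn fun k : Fin m => fTau h - algebraMap ℂ _ (v k)).prod 0

/-- The cyclotomic Hecke algebra `H(m,1,n)` over `ℂ` with parameters `q, v_1, …, v_m`. -/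
abbrev Hecke (n : ℕ) (q : ℂ) (v : Fin m → ℂ) : Type := RingQuot (HeckeRel n q v)

/-! ### The smash product `𝔗` -/

/-- Generators of `𝔗`: those of `H(m,1,n)`, and one generator for each standard `m`-tableau of
each shape of size `n`. -/
abbrev SGen (m n : ℕ) : Type := HGen n ⊕ (Σ lam : MPartition m n, StdTableau lam)

/-- The inclusion of free algebras induced by the inclusion of the generators of `H(m,1,n)`. -/
def inclH (m n : ℕ) : FreeAlgebra ℂ (HGen n) →ₐ[ℂ] FreeAlgebra ℂ (SGen m n) :=
  FreeAlgebra.lift ℂ fun g => FreeAlgebra.ι ℂ (Sum.inl g)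

open Classical in
/-- The symbol `𝒳_T` of a filling: the corresponding free generator if `T` is standard, and `0`
otherwise. -/
def fX {lam : MPartition m n} (T : Filling lam) : FreeAlgebra ℂ (SGen m n) :=
  if h : T.IsStandard then FreeAlgebra.ι ℂ (Sum.inr ⟨lam, ⟨T, h⟩⟩) else 0

/-- The defining relations of `𝔗`: those of `H(m,1,n)`, and for every standard `m`-tableau `T`,
with `c_j` the content of the node carrying `j`,
`(σ_i + (q-q⁻¹) c_{i+1} / (c_i - c_{i+1})) 𝒳_T = 𝒳_{T^{s_i}} (σ_i + (q-q⁻¹) c_i / (c_{i+1} - c_i))`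
and `(τ - c_1) 𝒳_T = 0`. -/
inductive SmashRel (n : ℕ) (q : ℂ) (v : Fin m → ℂ) :
    FreeAlgebra ℂ (SGen m n) → FreeAlgebra ℂ (SGen m n) → Prop
  | hecke {a b : FreeAlgebra ℂ (HGen n)} (h : HeckeRel n q v a b) :
      SmashRel n q v (inclH m n a) (inclH m n b)
  | sigma_X (lam : MPartition m n) (T : StdTableau lam) (i : ℕ) (h : i + 1 < n) (h' : i < n) :
      SmashRel n q v
        ((inclH m n (fSigma i h) + algebraMap ℂ _
          ((q - q⁻¹) * T.1.content q v ⟨i + 1, h⟩ /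
            (T.1.content q v ⟨i, h'⟩ - T.1.content q v ⟨i + 1, h⟩))) * fX T.1)
        (fX (T.1.perm (Equiv.swap ⟨i, h'⟩ ⟨i + 1, h⟩)) * (inclH m n (fSigma i h) + algebraMap ℂ _
          ((q - q⁻¹) * T.1.content q v ⟨i, h'⟩ /
            (T.1.content q v ⟨i + 1, h⟩ - T.1.content q v ⟨i, h'⟩))))
  | tau_X (lam : MPartition m n) (T : StdTableau lam) (h : 0 < n) :
      SmashRel n q v
        ((inclH m n (fTau h) - algebraMap ℂ _ (T.1.content q v ⟨0, h⟩)) * fX T.1) 0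

/-- The smash product `𝔗` of `H(m,1,n)` with the free algebra on the standard `m`-tableaux. -/
abbrev Smash (n : ℕ) (q : ℂ) (v : Fin m → ℂ) : Type := RingQuot (SmashRel n q v)

variable (q : ℂ) (v : Fin m → ℂ)

/-- The canonical homomorphism `H(m,1,n) → 𝔗`. -/
def heckeToSmash (n : ℕ) : Hecke n q v →ₐ[ℂ] Smash n q v :=
  RingQuot.liftAlgHom ℂ ⟨(RingQuot.mkAlgHom ℂ (SmashRel n q v)).comp (inclH m n),
    fun _ _ h => RingQuot.mkAlgHom_rel ℂ (SmashRel.hecke h)⟩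

/-- `τ` in `𝔗`. -/
def sTau (h : 0 < n) : Smash n q v := RingQuot.mkAlgHom ℂ (SmashRel n q v) (inclH m n (fTau h))

/-- `σ_{i+1}` in `𝔗`. -/
def sSigma (i : ℕ) (h : i + 1 < n) : Smash n q v :=
  RingQuot.mkAlgHom ℂ (SmashRel n q v) (inclH m n (fSigma i h))

/-- The element `𝒳_T` of `𝔗`, for a standard `m`-tableau `T`. -/
def sX {lam : MPartition m n} (T : StdTableau lam) : Smash n q v :=
  RingQuot.mkAlgHom ℂ (SmashRel n q v) (fX T.1)

/-! ### Evaluation on the vacuum -/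

/-- The left ideal of `𝔗` generated by `τ - v_1` and by `σ_i - q` for all `i`. -/
def vacuumIdeal [NeZero m] (n : ℕ) : Submodule (Smash n q v) (Smash n q v) :=
  Submodule.span (Smash n q v)
    ({x | ∃ h : 0 < n, x = sTau q v h - algebraMap ℂ _ (v 0)} ∪
      {x | ∃ (i : ℕ) (h : i + 1 < n), x = sSigma q v i h - algebraMap ℂ _ q})

/-- The left `𝔗`-module induced from the one-dimensional `H(m,1,n)`-module spanned by the vacuum
`|⟩`, on which `τ` acts as `v_1` and all `σ_i` act as `q`. -/
def VacuumModule [NeZero m] (n : ℕ) : Type := Smash n q v ⧸ vacuumIdeal q v n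

instance [NeZero m] : AddCommGroup (VacuumModule q v n) :=
  inferInstanceAs (AddCommGroup (Smash n q v ⧸ vacuumIdeal q v n))

instance [NeZero m] : Module (Smash n q v) (VacuumModule q v n) :=
  inferInstanceAs (Module (Smash n q v) (Smash n q v ⧸ vacuumIdeal q v n))

/-- `H(m,1,n)` acts through the canonical homomorphism to `𝔗`. -/
instance [NeZero m] : Module (Hecke n q v) (VacuumModule q v n) :=
  Module.compHom _ (heckeToSmash q v n).toRingHom

instance [NeZero m] : Module ℂ (VacuumModule q v n) :=
  Module.compHom _ (algebraMap ℂ (Smash n q v))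

instance [NeZero m] : IsScalarTower ℂ (Smash n q v) (VacuumModule q v n) where
  smul_assoc c a x := by
    change (c • a) • x = (algebraMap ℂ (Smash n q v) c) • (a • x)
    rw [Algebra.smul_def, mul_smul]

instance [NeZero m] : IsScalarTower ℂ (Hecke n q v) (VacuumModule q v n) where
  smul_assoc c a x := by
    change (heckeToSmash q v n (c • a)) • x = c • ((heckeToSmash q v n a) • x)
    rw [map_smul, smul_assoc]

/-- The vacuum vector `|⟩`. -/
def vacuum [NeZero m] (n : ℕ) : VacuumModule q v n :=
  Submodule.Quotient.mk (p := vacuumIdeal q v n) (1 : Smash n q v)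

/-- The vector `𝒳_T |⟩`. -/
def vec [NeZero m] {lam : MPartition m n} (T : StdTableau lam) : VacuumModule q v n :=
  sX q v T • vacuum q v n

/-- The vector `𝒳_T 𝒳_S |⟩`. -/
def vec₂ [NeZero m] {lam mu : MPartition m n} (T : StdTableau lam) (S : StdTableau mu) :
    VacuumModule q v n :=
  (sX q v T * sX q v S) • vacuum q v n

/-- The `H(m,1,n)`-module `V_λ`, generated by the vectors `𝒳_T |⟩` with `T` standard of shape
`λ`. -/
def V [NeZero m] (lam : MPartition m n) : Submodule (Hecke n q v) (VacuumModule q v n) :=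
  Submodule.span (Hecke n q v) (Set.range fun T : StdTableau lam => vec q v T)

/-- The `H(m,1,n)`-module `V_λ ⊗̂ V_μ`, generated by the vectors `𝒳_T 𝒳_S |⟩` with `T` and `S`
standard of shapes `λ` and `μ`. -/
def VTensor [NeZero m] (lam mu : MPartition m n) :
    Submodule (Hecke n q v) (VacuumModule q v n) :=
  Submodule.span (Hecke n q v)
    (Set.range fun p : StdTableau lam × StdTableau mu => vec₂ q v p.1 p.2)

end

end CyclotomicHecke

open CyclotomicHecke

namespace CyclotomicHecke

noncomputable section

variable {m n : ℕ}

/-! Spanning is formal: the relations of `Smash` move `σ` and `τ` to the right through a tableau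
generator, so if the span of vectors `w` is stable under the Hecke algebra, so is the span of all
`𝒳_T w` for a fixed shape (`HStable.sX_span`). Starting from the vacuum, this is used once for `V`
and twice for `VTensor`.

Linear independence needs a model. For every representation `ρ` of the Hecke algebra on `U`, the
relations dictate an action on `U`-valued functions on the standard tableaux of a shape; `tabRep`
shows that it is a representation. Genericity enters here: nearby entries of a standard tableau have
distinct contents, so the coefficients make sense, and exchanging `i` and `i + 1` destroys
standardness exactly when the two contents have ratio `q²` or `q⁻²`. At these ratios `1 + alpha q x
y * alpha q y x` vanishes, so setting nonstandard components to zero does not break the relations.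
Iterating from the vacuum character gives models in degrees 0, 1 and 2; their sum is a
representation of `Smash` in which the words in question become distinct basis vectors
(`exists_vec_maps`).

For the isomorphism, `VTensor` is modelled by `tabRep (rep₁ hg mu) hg lam`, and the claim is that
`tabRep ρ` does not depend on `ρ` up to isomorphism, only on the space `U`. An operator acting by `g
T` on the component of `T` turns the construction for the scalar character into the one for `ρ` as
soon as `g (T^{s_i}) = bax_i(T) * g T`, with `bax` the normalized baxterized generator at the
contents of `T`. This is a flat connection on the graph of standard tableaux: unitarity, far
commutativity and the Yang–Baxter equation give trivial holonomy, and `exists_isGauge` builds a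
solution. For a scalar character the construction is functorial in `U`, so a basis of `U` splits it
into copies of the degree 1 model. -/

/-- The genericity conditions on the parameters. -/
structure Generic (n : ℕ) (q : ℂ) (v : Fin m → ℂ) : Prop where
  q_ne_zero : q ≠ 0
  sq_ne_one : 2 ≤ n → q ^ 2 ≠ 1
  geom_ne_zero : ∀ N : ℕ, N < n → ∑ j ∈ Finset.range (N + 1), q ^ (2 * j) ≠ 0
  separated : ∀ (i : ℤ) (j k : Fin m), j ≠ k → -(n : ℤ) < i → i < (n : ℤ) →
      q ^ (2 * i) * v j - v k ≠ 0
  v_ne_zero : ∀ j : Fin m, v j ≠ 0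

/-! ### Consequences of genericity: the content determines the diagram and the diagonal. -/

theorem Generic.pow_ne_one {q : ℂ} {v : Fin m → ℂ} (hg : Generic n q v) (hn : 2 ≤ n) {k : ℕ}
    (hk : 0 < k) (hkn : k ≤ n) : q ^ (2 * k) ≠ 1 := by
  obtain ⟨N, rfl⟩ : ∃ N, k = N + 1 := ⟨k - 1, by omega⟩
  intro h
  have h2 : (∑ j ∈ Finset.range (N + 1), (q ^ 2) ^ j) * (q ^ 2 - 1) = 0 := by
    rw [geom_sum_mul, ← pow_mul, h, sub_self]
  rcases mul_eq_zero.1 h2 with h3 | h3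
  · exact hg.geom_ne_zero N (by omega) (by simpa only [pow_mul] using h3)
  · exact hg.sq_ne_one hn (sub_eq_zero.1 h3)

theorem Generic.zpow_ne_one {q : ℂ} {v : Fin m → ℂ} (hg : Generic n q v) (hn : 2 ≤ n) {k : ℤ}
    (hk : k ≠ 0) (h1 : -(n : ℤ) ≤ k) (h2 : k ≤ n) : q ^ (2 * k) ≠ 1 := by
  obtain ⟨d, rfl | rfl⟩ := k.eq_nat_or_neg
  · have := hg.pow_ne_one hn (k := d) (by omega) (by omega)
    exact_mod_cast this
  · have := hg.pow_ne_one hn (k := d) (by omega) (by omega)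
    intro h
    rw [mul_neg, zpow_neg, inv_eq_one] at h
    exact this (by exact_mod_cast h)

/-- The hook with corner `(0, 0)` ending at these two cells has `r + s + 1` cells. This bounds
content exponents by `n`, the range in which genericity is assumed. -/
theorem add_lt_card_of_mem (d : YoungDiagram) {r s : ℕ} (hr : (r, 0) ∈ d) (hs : (0, s) ∈ d) :
    r + s < d.card := by
  have := Finset.card_le_card_of_injOn (s := Finset.range (r + s + 1)) (t := d.cells)
    (fun t => if t ≤ r then (t, 0) else (0, t - r)) ?_ ?_
  · simpa using this
  · intro t ht
    simp only [Finset.coe_range, Set.mem_Iio] at ht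
    dsimp only
    split_ifs with h
    · exact d.up_left_mem h le_rfl hr
    · exact d.up_left_mem le_rfl (by omega) hs
  · intro t ht t' ht' h
    dsimp only at h
    split_ifs at h <;> simp only [Prod.mk.injEq] at h <;> omega

namespace MPartition.Node

variable {lam : MPartition m n}

@[ext] theorem ext {x y : lam.Node} (h1 : x.pos = y.pos) (h2 : x.row = y.row)
    (h3 : x.col = y.col) : x = y :=
  Subtype.ext (Prod.ext h1 (Prod.ext h2 h3))

theorem mem (x : lam.Node) : (x.row, x.col) ∈ lam.diag x.pos := x.2

/-- The content of an `m`-node. -/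
def cont (q : ℂ) (v : Fin m → ℂ) (x : lam.Node) : ℂ :=
  v x.pos * q ^ (2 * ((x.col : ℤ) - (x.row : ℤ)))

/-- The `m`-node in the same diagram as `y`, up and to the left of `y`. -/
def upLeft (y : lam.Node) (r s : ℕ) (hr : r ≤ y.row) (hs : s ≤ y.col) : lam.Node :=
  ⟨(y.pos, r, s), (lam.diag y.pos).up_left_mem hr hs y.2⟩

theorem row_add_col_lt (x y : lam.Node) (h : x.pos = y.pos) : x.row + y.col < n := by
  have h1 : (x.row, 0) ∈ lam.diag x.pos := (lam.diag _).up_left_mem le_rfl (Nat.zero_le _) x.mem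
  have h2 : (0, y.col) ∈ lam.diag x.pos := by
    rw [h]; exact (lam.diag _).up_left_mem (Nat.zero_le _) le_rfl y.mem
  have h3 := add_lt_card_of_mem _ h1 h2
  have h4 := Finset.single_le_sum (f := fun k => (lam.diag k).card) (fun k _ => Nat.zero_le _)
    (Finset.mem_univ x.pos)
  rw [lam.size_eq] at h4
  omega

/-- A leg in one diagram and an arm in another share no corner, which gains one over
`row_add_col_lt`. The gain leaves room for the shift `δ` in `eq_of_cont_eq`, as `separated` covers
only exponents strictly between `-n` and `n`. -/
theorem row_add_col_add_one_lt (x y : lam.Node) (h : x.pos ≠ y.pos) : x.row + y.col + 1 < n := by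
  have h1 : (x.row, 0) ∈ lam.diag x.pos := (lam.diag _).up_left_mem le_rfl (Nat.zero_le _) x.mem
  have h1' : (0, 0) ∈ lam.diag x.pos := (lam.diag _).up_left_mem (Nat.zero_le _) le_rfl h1
  have h2 : (0, y.col) ∈ lam.diag y.pos :=
    (lam.diag _).up_left_mem (Nat.zero_le _) le_rfl y.mem
  have h2' : (0, 0) ∈ lam.diag y.pos := (lam.diag _).up_left_mem le_rfl (Nat.zero_le _) h2
  have h3 := add_lt_card_of_mem _ h1 h1'
  have h3' := add_lt_card_of_mem _ h2' h2
  have h4 : ∑ k ∈ {x.pos, y.pos}, (lam.diag k).card ≤ ∑ k, (lam.diag k).card :=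
    Finset.sum_le_sum_of_subset (Finset.subset_univ _)
  rw [lam.size_eq, Finset.sum_pair h] at h4
  omega

theorem eq_of_cont_eq {q : ℂ} {v : Fin m → ℂ} (hg : Generic n q v) (hn : 2 ≤ n)
    (x y : lam.Node) (δ : ℤ) (hδ : -1 ≤ δ) (hδ' : δ ≤ 1)
    (h : q ^ (2 * δ) * x.cont q v = y.cont q v) :
    x.pos = y.pos ∧ (y.col : ℤ) - y.row = (x.col : ℤ) - x.row + δ := by
  have hq := hg.q_ne_zero
  have key : q ^ (2 * ((x.col : ℤ) - x.row + δ - (y.col - y.row))) * v x.pos = v y.pos := by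
    have e : (2 * ((x.col : ℤ) - x.row + δ - (y.col - y.row))) =
        2 * δ + 2 * ((x.col : ℤ) - x.row) - 2 * (y.col - y.row) := by ring
    rw [e, zpow_sub₀ hq, zpow_add₀ hq]
    have := zpow_ne_zero (2 * ((y.col : ℤ) - y.row)) hq
    unfold cont at h
    field_simp
    linear_combination h
  have hpos : x.pos = y.pos := by
    by_contra hne
    have a1 := row_add_col_add_one_lt x y hne
    have a2 := row_add_col_add_one_lt y x (Ne.symm hne)
    exact hg.separated _ _ _ hne (by omega) (by omega) (sub_eq_zero.2 key)
  refine ⟨hpos, ?_⟩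
  by_contra hne
  have a1 := row_add_col_lt x y hpos
  have a2 := row_add_col_lt y x hpos.symm
  refine hg.zpow_ne_one hn (k := (x.col : ℤ) - x.row + δ - (y.col - y.row)) (by omega) (by omega)
    (by omega) ?_
  rw [hpos] at key
  exact mul_right_cancel₀ (hg.v_ne_zero y.pos) (by rw [key, one_mul])

end MPartition.Node

/-! ### Standard fillings and adjacent transpositions. -/

namespace Filling

variable {lam : MPartition m n}

/-- The filling `T` with the numbers at places `i`, `i + 1` (counted from `0`) exchanged. -/
def sw (T : Filling lam) (i : ℕ) (h : i + 1 < n) : Filling lam :=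
  T.perm (Equiv.swap ⟨i, by omega⟩ ⟨i + 1, h⟩)

theorem sw_apply (T : Filling lam) (i : ℕ) (h : i + 1 < n) (j : Fin n) :
    T.sw i h j = T (Equiv.swap ⟨i, by omega⟩ ⟨i + 1, h⟩ j) := rfl

theorem sw_left (T : Filling lam) (i : ℕ) (h : i + 1 < n) (h' : i < n) :
    T.sw i h ⟨i, h'⟩ = T ⟨i + 1, h⟩ := by
  rw [sw_apply, Equiv.swap_apply_left]

theorem sw_right (T : Filling lam) (i : ℕ) (h : i + 1 < n) :
    T.sw i h ⟨i + 1, h⟩ = T ⟨i, by omega⟩ := by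
  rw [sw_apply, Equiv.swap_apply_right]

theorem sw_of_ne (T : Filling lam) (i : ℕ) (h : i + 1 < n) (j : ℕ) (hj : j < n) (h1 : j ≠ i)
    (h2 : j ≠ i + 1) : T.sw i h ⟨j, hj⟩ = T ⟨j, hj⟩ := by
  rw [sw_apply, Equiv.swap_apply_of_ne_of_ne] <;> simpa

@[simp] theorem sw_sw (T : Filling lam) (i : ℕ) (h : i + 1 < n) : (T.sw i h).sw i h = T := by
  ext1 j
  simp [sw_apply]

theorem sw_comm (T : Filling lam) (i j : ℕ) (hi : i + 1 < n) (hj : j + 1 < n) (hij : i + 1 < j) :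
    (T.sw i hi).sw j hj = (T.sw j hj).sw i hi := by
  ext1 k
  simp only [sw_apply, Equiv.swap_apply_def]
  congr 1
  simp only [Fin.ext_iff, apply_ite Fin.val]
  split_ifs <;> omega

theorem sw_braid (T : Filling lam) (i : ℕ) (hi : i + 1 < n) (hj : i + 1 + 1 < n) :
    ((T.sw i hi).sw (i + 1) hj).sw i hi = ((T.sw (i + 1) hj).sw i hi).sw (i + 1) hj := by
  ext1 k
  simp only [sw_apply, Equiv.swap_apply_def]
  congr 1
  simp only [Fin.ext_iff, apply_ite Fin.val]
  split_ifs <;> omega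

namespace IsStandard

variable {T : Filling lam}

/-- Go along the row of the first node to the column of the second, then down; the corner of this
path is in the diagram because it lies above the second node. -/
theorem le_of_le (hT : T.IsStandard) {i j : Fin n} (hpos : (T i).pos = (T j).pos)
    (hr : (T i).row ≤ (T j).row) (hc : (T i).col ≤ (T j).col) : i ≤ j := by
  let z : lam.Node := (T j).upLeft (T i).row (T j).col hr le_rfl
  obtain ⟨k, hk⟩ := T.surjective z
  have zpos : (T k).pos = (T j).pos := by rw [hk]; rfl
  have zrow : (T k).row = (T i).row := by rw [hk]; rfl
  have zcol : (T k).col = (T j).col := by rw [hk]; rfl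
  have h1 : i ≤ k := by
    rcases hc.lt_or_eq with h | h
    · exact (hT.1 i k (hpos.trans zpos.symm) zrow.symm (zcol ▸ h)).le
    · exact (T.injective (MPartition.Node.ext (hpos.trans zpos.symm) zrow.symm
        (h.trans zcol.symm))).le
  have h2 : k ≤ j := by
    rcases hr.lt_or_eq with h | h
    · exact (hT.2 k j zpos zcol (zrow ▸ h)).le
    · exact (T.injective (MPartition.Node.ext zpos (zrow.trans h) zcol)).le
  exact h1.trans h2

/-- Equal contents put both nodes on one diagonal of one diagram. Then the right and lower
neighbours of the first node carry two different numbers strictly between `i` and `j`, so `j ≥ i +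
3`. Distance at most two is all that the defining relations involve. -/
theorem cont_ne {q : ℂ} {v : Fin m → ℂ} (hg : Generic n q v) (hT : T.IsStandard)
    (i j : Fin n) (hij : i < j) (hji : (j : ℕ) < i + 3) :
    (T i).cont q v ≠ (T j).cont q v := by
  intro h
  have hn : 2 ≤ n := by have := j.2; have : (i : ℕ) < j := hij; omega
  obtain ⟨hpos, hd⟩ := MPartition.Node.eq_of_cont_eq hg hn (T i) (T j) 0 (by simp) (by simp)
    (by simpa using h)
  by_cases hr : (T j).row ≤ (T i).row
  · exact absurd (hT.le_of_le hpos.symm hr (by omega)) (by simpa using hij)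
  · obtain ⟨k, hk⟩ := T.surjective
      ((T j).upLeft ((T i).row + 1) (T i).col (by omega) (by omega))
    obtain ⟨l, hl⟩ := T.surjective
      ((T j).upLeft (T i).row ((T i).col + 1) (by omega) (by omega))
    have kpos : (T k).pos = (T j).pos := by rw [hk]; rfl
    have krow : (T k).row = (T i).row + 1 := by rw [hk]; rfl
    have kcol : (T k).col = (T i).col := by rw [hk]; rfl
    have lpos : (T l).pos = (T j).pos := by rw [hl]; rfl
    have lrow : (T l).row = (T i).row := by rw [hl]; rfl
    have lcol : (T l).col = (T i).col + 1 := by rw [hl]; rfl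
    have h1 : i < k := hT.2 i k (hpos.trans kpos.symm) kcol.symm (by omega)
    have h2 : i < l := hT.1 i l (hpos.trans lpos.symm) lrow.symm (by omega)
    have h3 : k < j := (hT.le_of_le kpos (by omega) (by omega)).lt_of_ne (by
      rintro rfl; omega)
    have h4 : l < j := (hT.le_of_le lpos (by omega) (by omega)).lt_of_ne (by
      rintro rfl; omega)
    have h5 : k ≠ l := by rintro rfl; omega
    have : (k : ℕ) ≠ l := fun h => h5 (Fin.ext h)
    simp only [Fin.lt_def] at h1 h2 h3 h4
    omega

/-- Exchanging consecutive numbers reverses the order of that pair only, so any violation of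
standardness comes from the two exchanged nodes. -/
theorem adjacent_of_not_sw (hT : T.IsStandard) (i : ℕ) (h : i + 1 < n)
    (hs : ¬ (T.sw i h).IsStandard) :
    (T ⟨i, by omega⟩).pos = (T ⟨i + 1, h⟩).pos ∧
    ((T ⟨i, by omega⟩).row = (T ⟨i + 1, h⟩).row ∧ (T ⟨i, by omega⟩).col < (T ⟨i + 1, h⟩).col ∨
      (T ⟨i, by omega⟩).col = (T ⟨i + 1, h⟩).col ∧
        (T ⟨i, by omega⟩).row < (T ⟨i + 1, h⟩).row) := by
  have key : ∀ a b : Fin n, ¬ a < b →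
      Equiv.swap (⟨i, by omega⟩ : Fin n) ⟨i + 1, h⟩ a <
        Equiv.swap (⟨i, by omega⟩ : Fin n) ⟨i + 1, h⟩ b →
      Equiv.swap (⟨i, by omega⟩ : Fin n) ⟨i + 1, h⟩ a = ⟨i, by omega⟩ ∧
        Equiv.swap (⟨i, by omega⟩ : Fin n) ⟨i + 1, h⟩ b = ⟨i + 1, h⟩ := by
    intro a b hab
    simp only [Equiv.swap_apply_def, Fin.ext_iff, Fin.lt_def, apply_ite Fin.val]
    split_ifs <;> omega
  simp only [IsStandard, not_and_or, not_forall] at hs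
  rcases hs with ⟨a, b, h1, h2, h3, h4⟩ | ⟨a, b, h1, h2, h3, h4⟩
  · rw [sw_apply, sw_apply] at h1 h2 h3
    obtain ⟨ha, hb⟩ := key a b h4 (hT.1 _ _ h1 h2 h3)
    rw [ha, hb] at h1 h2 h3
    exact ⟨h1, Or.inl ⟨h2, h3⟩⟩
  · rw [sw_apply, sw_apply] at h1 h2 h3
    obtain ⟨ha, hb⟩ := key a b h4 (hT.2 _ _ h1 h2 h3)
    rw [ha, hb] at h1 h2 h3
    exact ⟨h1, Or.inr ⟨h2, h3⟩⟩

/-- The two nodes share a row or a column and must be neighbours there: a node between them would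
carry a number strictly between `i` and `i + 1`. -/
theorem cont_of_not_sw {q : ℂ} {v : Fin m → ℂ} (hg : Generic n q v) (hT : T.IsStandard)
    (i : ℕ) (h : i + 1 < n) (hs : ¬ (T.sw i h).IsStandard) :
    (T ⟨i + 1, h⟩).cont q v = q ^ 2 * (T ⟨i, by omega⟩).cont q v ∨
      (T ⟨i, by omega⟩).cont q v = q ^ 2 * (T ⟨i + 1, h⟩).cont q v := by
  have hq := hg.q_ne_zero
  obtain ⟨hpos, ⟨h1, h2⟩ | ⟨h1, h2⟩⟩ := hT.adjacent_of_not_sw i h hs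
  · left
    have hc : (T ⟨i + 1, h⟩).col = (T ⟨i, by omega⟩).col + 1 := by
      by_contra hne
      obtain ⟨k, hk⟩ := T.surjective ((T ⟨i + 1, h⟩).upLeft (T ⟨i, by omega⟩).row
        ((T ⟨i, by omega⟩).col + 1) (by omega) (by omega))
      have kpos : (T k).pos = (T ⟨i + 1, h⟩).pos := by rw [hk]; rfl
      have krow : (T k).row = (T ⟨i, by omega⟩).row := by rw [hk]; rfl
      have kcol : (T k).col = (T ⟨i, by omega⟩).col + 1 := by rw [hk]; rfl
      have a := hT.1 ⟨i, by omega⟩ k (hpos.trans kpos.symm) krow.symm (by omega)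
      have b := hT.1 k ⟨i + 1, h⟩ kpos (krow.trans h1) (by omega)
      simp only [Fin.lt_def] at a b
      omega
    have e : (2 * (((T ⟨i, by omega⟩).col + 1 : ℕ) - (T ⟨i + 1, h⟩).row : ℤ)) =
      2 * ((T ⟨i, by omega⟩).col - (T ⟨i + 1, h⟩).row : ℤ) + 2 := by push_cast; ring
    unfold MPartition.Node.cont
    rw [hpos, hc, h1, e, zpow_add₀ hq]
    norm_cast
    ring
  · right
    have hc : (T ⟨i + 1, h⟩).row = (T ⟨i, by omega⟩).row + 1 := by
      by_contra hne
      obtain ⟨k, hk⟩ := T.surjective ((T ⟨i + 1, h⟩).upLeft ((T ⟨i, by omega⟩).row + 1)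
        (T ⟨i, by omega⟩).col (by omega) (by omega))
      have kpos : (T k).pos = (T ⟨i + 1, h⟩).pos := by rw [hk]; rfl
      have krow : (T k).row = (T ⟨i, by omega⟩).row + 1 := by rw [hk]; rfl
      have kcol : (T k).col = (T ⟨i, by omega⟩).col := by rw [hk]; rfl
      have a := hT.2 ⟨i, by omega⟩ k (hpos.trans kpos.symm) kcol.symm (by omega)
      have b := hT.2 k ⟨i + 1, h⟩ kpos (kcol.trans h1) (by omega)
      simp only [Fin.lt_def] at a b
      omega
    have e : (2 * ((T ⟨i, by omega⟩).col - (T ⟨i, by omega⟩).row : ℤ)) =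
      2 * ((T ⟨i, by omega⟩).col - ((T ⟨i, by omega⟩).row + 1 : ℕ) : ℤ) + 2 := by push_cast; ring
    unfold MPartition.Node.cont
    rw [e, hpos, hc, h1, zpow_add₀ hq]
    norm_cast
    ring

/-- By genericity the nodes lie on neighbouring diagonals of one diagram, hence one is weakly up and
left of the other. This fixes the order of their numbers in every standard filling. -/
theorem not_sw_of_cont {q : ℂ} {v : Fin m → ℂ} (hg : Generic n q v) (hT : T.IsStandard)
    (i : ℕ) (h : i + 1 < n)
    (hc : (T ⟨i + 1, h⟩).cont q v = q ^ 2 * (T ⟨i, by omega⟩).cont q v ∨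
      (T ⟨i, by omega⟩).cont q v = q ^ 2 * (T ⟨i + 1, h⟩).cont q v) :
    ¬ (T.sw i h).IsStandard := by
  intro hs
  have hq := hg.q_ne_zero
  obtain ⟨hpos, hd⟩ : (T ⟨i, by omega⟩).pos = (T ⟨i + 1, h⟩).pos ∧
      (((T ⟨i + 1, h⟩).col : ℤ) - (T ⟨i + 1, h⟩).row =
        ((T ⟨i, by omega⟩).col : ℤ) - (T ⟨i, by omega⟩).row + 1 ∨
      ((T ⟨i + 1, h⟩).col : ℤ) - (T ⟨i + 1, h⟩).row =
        ((T ⟨i, by omega⟩).col : ℤ) - (T ⟨i, by omega⟩).row - 1) := by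
    rcases hc with hc | hc
    · obtain ⟨h1, h2⟩ := MPartition.Node.eq_of_cont_eq hg (by omega) (T ⟨i, by omega⟩)
        (T ⟨i + 1, h⟩) 1 (by simp) (by simp) (by rw [hc]; norm_cast)
      exact ⟨h1, Or.inl h2⟩
    · obtain ⟨h1, h2⟩ := MPartition.Node.eq_of_cont_eq hg (by omega) (T ⟨i + 1, h⟩)
        (T ⟨i, by omega⟩) 1 (by simp) (by simp) (by rw [hc]; norm_cast)
      exact ⟨h1.symm, Or.inr (by omega)⟩
  have noLe : ¬ ((T ⟨i + 1, h⟩).row ≤ (T ⟨i, by omega⟩).row ∧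
      (T ⟨i + 1, h⟩).col ≤ (T ⟨i, by omega⟩).col) := by
    rintro ⟨h1, h2⟩
    have := hT.le_of_le hpos.symm h1 h2
    simp [Fin.le_def] at this
  have noLe' : ¬ ((T ⟨i, by omega⟩).row ≤ (T ⟨i + 1, h⟩).row ∧
      (T ⟨i, by omega⟩).col ≤ (T ⟨i + 1, h⟩).col) := by
    rintro ⟨h1, h2⟩
    have := hs.le_of_le (i := ⟨i + 1, h⟩) (j := ⟨i, by omega⟩)
      (by rw [sw_left, sw_right]; exact hpos) (by rw [sw_left, sw_right]; exact h1)
      (by rw [sw_left, sw_right]; exact h2)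
    simp [Fin.le_def] at this
  omega

theorem content_zero {q : ℂ} {v : Fin m → ℂ} (hT : T.IsStandard) (h : 0 < n) :
    (T ⟨0, h⟩).cont q v = v (T ⟨0, h⟩).pos := by
  obtain ⟨k, hk⟩ := T.surjective ((T ⟨0, h⟩).upLeft 0 0 (Nat.zero_le _) (Nat.zero_le _))
  have kpos : (T k).pos = (T ⟨0, h⟩).pos := by rw [hk]; rfl
  have krow : (T k).row = 0 := by rw [hk]; rfl
  have kcol : (T k).col = 0 := by rw [hk]; rfl
  have := hT.le_of_le kpos (by omega) (by omega)
  have hk0 : k = ⟨0, h⟩ := Fin.ext (by simpa [Fin.le_def] using this)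
  subst hk0
  simp [MPartition.Node.cont, krow, kcol]

end IsStandard

end Filling

/-! ### Identities between the coefficients. -/

/-- The coefficient `(q - q⁻¹) y / (x - y)`. -/
def alpha (q x y : ℂ) : ℂ := (q - q⁻¹) * y / (x - y)

open Classical in
/-- The indicator of `x / y ∉ {q², q⁻²}`. -/
def cut (q x y : ℂ) : ℂ := if y = q ^ 2 * x ∨ x = q ^ 2 * y then 0 else 1

theorem cut_comm (q x y : ℂ) : cut q x y = cut q y x := by
  simp only [cut, or_comm]

theorem alpha_add_alpha {q x y : ℂ} (h : x ≠ y) :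
    alpha q x y + alpha q y x = -(q - q⁻¹) := by
  have := sub_ne_zero.2 h
  have := sub_ne_zero.2 h.symm
  unfold alpha
  field_simp
  ring

theorem one_add_alpha_mul {q x y : ℂ} (hq : q ≠ 0) (h : x ≠ y) :
    1 + alpha q x y * alpha q y x = (q ^ 2 * x - y) * (q ^ 2 * y - x) / (- q ^ 2 * (x - y) ^ 2) := by
  have := sub_ne_zero.2 h
  have := sub_ne_zero.2 h.symm
  unfold alpha
  field_simp
  ring

/-- The right side already vanishes wherever `cut` does. This is what makes truncation to standard
tableaux compatible with the Hecke relations. -/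
theorem cut_sq_mul {q x y : ℂ} (hq : q ≠ 0) (h : x ≠ y) :
    cut q x y * cut q x y * (1 + alpha q x y * alpha q y x) = 1 + alpha q x y * alpha q y x := by
  rw [one_add_alpha_mul hq h, cut]
  split_ifs with hc
  · rcases hc with rfl | rfl <;> simp
  · simp

/-- The scalar content of the Yang–Baxter equation, used for the braid relation on tableaux and for
`bax_braid`. -/
theorem alpha_braid {q x y z : ℂ} (hxy : x ≠ y) (hxz : x ≠ z) (hyz : y ≠ z) :
    (q - q⁻¹) * alpha q x z + alpha q x z * (alpha q x y + alpha q y z) -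
      alpha q x y * alpha q y z = 0 := by
  have := sub_ne_zero.2 hxy
  have := sub_ne_zero.2 hxz
  have := sub_ne_zero.2 hyz
  unfold alpha
  field_simp
  ring

/-! ### The relations on a single orbit of fillings. -/

section Abstract

variable {U M : Type*} [AddCommGroup U] [Module ℂ U] [AddCommGroup M] [Module ℂ M]

/-- Here `k` and `k'` are the components of a filling and of its exchange; only distinctness of the
two contents is used, so `k'` may belong to a nonstandard filling. -/
theorem quadratic_aux {q x y : ℂ} (hq : q ≠ 0) (hxy : x ≠ y) {s : Module.End ℂ U}
    (hs : ∀ u, s (s u) = (q - q⁻¹) • s u + u) {A : Module.End ℂ M} {k k' : U →ₗ[ℂ] M}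
    (h : ∀ u, A (k u) = k' (cut q x y • (s u + alpha q y x • u)) - alpha q x y • k u)
    (h' : ∀ u, A (k' u) = k (cut q y x • (s u + alpha q x y • u)) - alpha q y x • k' u) (u : U) :
    A (A (k u)) = (q - q⁻¹) • A (k u) + k u := by
  have e := cut_sq_mul hq hxy
  have a := alpha_add_alpha (q := q) hxy
  rw [cut_comm q y x] at h'
  simp only [h, h', map_add, map_sub, map_smul, hs]
  generalize cut q x y = c at *
  generalize alpha q x y = a1 at *
  generalize alpha q y x = a2 at *
  generalize q - q⁻¹ = κ at *
  obtain rfl : κ = -(a1 + a2) := by rw [a, neg_neg]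
  match_scalars
  · ring
  · linear_combination e
  · ring
  · ring

theorem tau_braid_aux {q x y : ℂ} (hq : q ≠ 0) (hxy : x ≠ y) {s : Module.End ℂ U}
    (hs : ∀ u, s (s u) = (q - q⁻¹) • s u + u) {A B : Module.End ℂ M} {k k' : U →ₗ[ℂ] M}
    (h : ∀ u, A (k u) = k' (cut q x y • (s u + alpha q y x • u)) - alpha q x y • k u)
    (h' : ∀ u, A (k' u) = k (cut q y x • (s u + alpha q x y • u)) - alpha q y x • k' u)
    (hB : ∀ u, B (k u) = x • k u) (hB' : ∀ u, B (k' u) = y • k' u) (u : U) :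
    B (A (B (A (k u)))) = A (B (A (B (k u)))) := by
  have a := alpha_add_alpha (q := q) hxy
  have b : x * alpha q x y + y * alpha q y x = 0 := by
    have := sub_ne_zero.2 hxy
    have := sub_ne_zero.2 hxy.symm
    unfold alpha
    field_simp
    ring
  rw [cut_comm q y x] at h'
  simp only [h, h', hB, hB', map_add, map_sub, map_smul, hs]
  generalize cut q x y = c at *
  generalize alpha q x y = a1 at *
  generalize alpha q y x = a2 at *
  generalize q - q⁻¹ = κ at *
  obtain rfl : κ = -(a1 + a2) := by rw [a, neg_neg]
  match_scalars
  · ring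
  · ring
  · linear_combination c * (x - y) * b
  · linear_combination c * a2 * (x - y) * b

/-- The subscripts record the order of the contents in the six fillings of an orbit of three
consecutive numbers. The formulas supplied are those met on the two routes from `kxyz`. -/
theorem braid_aux {q x y z : ℂ} (hq : q ≠ 0) (hxy : x ≠ y) (hxz : x ≠ z) (hyz : y ≠ z)
    {s t : Module.End ℂ U}
    (hs : ∀ u, s (s u) = (q - q⁻¹) • s u + u) (ht : ∀ u, t (t u) = (q - q⁻¹) • t u + u)
    (hst : ∀ u, s (t (s u)) = t (s (t u)))
    {A B : Module.End ℂ M} {kxyz kyxz kxzy kyzx kzxy kzyx : U →ₗ[ℂ] M}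
    (A1 : ∀ u, A (kxyz u) = kyxz (cut q x y • (s u + alpha q y x • u)) - alpha q x y • kxyz u)
    (A2 : ∀ u, A (kyxz u) = kxyz (cut q y x • (s u + alpha q x y • u)) - alpha q y x • kyxz u)
    (A3 : ∀ u, A (kxzy u) = kzxy (cut q x z • (s u + alpha q z x • u)) - alpha q x z • kxzy u)
    (A5 : ∀ u, A (kyzx u) = kzyx (cut q y z • (s u + alpha q z y • u)) - alpha q y z • kyzx u)
    (B1 : ∀ u, B (kxyz u) = kxzy (cut q y z • (t u + alpha q z y • u)) - alpha q y z • kxyz u)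
    (B2 : ∀ u, B (kxzy u) = kxyz (cut q z y • (t u + alpha q y z • u)) - alpha q z y • kxzy u)
    (B3 : ∀ u, B (kyxz u) = kyzx (cut q x z • (t u + alpha q z x • u)) - alpha q x z • kyxz u)
    (B5 : ∀ u, B (kzxy u) = kzyx (cut q x y • (t u + alpha q y x • u)) - alpha q x y • kzxy u)
    (u : U) :
    A (B (A (kxyz u))) = B (A (B (kxyz u))) := by
  have e1 := cut_sq_mul hq hxy
  have e3 := cut_sq_mul hq hyz
  have a1 := alpha_add_alpha (q := q) hxy
  have a2 := alpha_add_alpha (q := q) hxz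
  have a3 := alpha_add_alpha (q := q) hyz
  have b := alpha_braid (q := q) hxy hxz hyz
  rw [cut_comm q y x] at A2
  rw [cut_comm q z y] at B2
  simp only [A1, A2, A3, A5, B1, B2, B3, B5, map_add, map_sub, map_smul, hs, ht, hst]
  generalize cut q x y = c1 at *
  generalize cut q x z = c2 at *
  generalize cut q y z = c3 at *
  generalize alpha q x y = p at *
  generalize alpha q y x = p' at *
  generalize alpha q x z = r at *
  generalize alpha q z x = r' at *
  generalize alpha q y z = t at *
  generalize alpha q z y = t' at *
  generalize q - q⁻¹ = κ at *
  obtain rfl : p' = -p - κ := by linear_combination a1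
  obtain rfl : r' = -r - κ := by linear_combination a2
  obtain rfl : t' = -t - κ := by linear_combination a3
  match_scalars
  all_goals first
    | ring1
    -- The scalar coefficient of the starting component: each route can leave it and return, which
    -- produces the squared cut factors.
    | linear_combination (-r) * e1 + r * e3 + (p - t) * b
    | linear_combination c1 * b
    | linear_combination -c1 * b
    | linear_combination c3 * b
    | linear_combination -c3 * b
    | linear_combination c1 * c2 * c3 * b
    | linear_combination -c1 * c2 * c3 * b
    | linear_combination c1 * (p + κ) * b
    | linear_combination -c1 * (p + κ) * b
    | linear_combination c3 * (t + κ) * b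
    | linear_combination -c3 * (t + κ) * b

end Abstract

/-! ### Generators and relations of the Hecke algebra. -/

namespace Hecke

variable (q : ℂ) (v : Fin m → ℂ)

/-- `τ` in the Hecke algebra. -/
def tau (h : 0 < n) : Hecke n q v := RingQuot.mkAlgHom ℂ (HeckeRel n q v) (fTau h)

/-- `σ_{i+1}` in the Hecke algebra. -/
def sigma (i : ℕ) (h : i + 1 < n) : Hecke n q v :=
  RingQuot.mkAlgHom ℂ (HeckeRel n q v) (fSigma i h)

theorem sigma_sq (i : ℕ) (h : i + 1 < n) :
    sigma q v i h * sigma q v i h = (q - q⁻¹) • sigma q v i h + 1 := by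
  have := RingQuot.mkAlgHom_rel ℂ (HeckeRel.quadratic (q := q) (v := v) i h)
  simp only [map_mul, map_add, map_smul, map_one] at this
  exact this

theorem sigma_braid (i : ℕ) (h : i + 1 + 1 < n) (h' : i + 1 < n) :
    sigma q v i h' * sigma q v (i + 1) h * sigma q v i h' =
      sigma q v (i + 1) h * sigma q v i h' * sigma q v (i + 1) h := by
  have := RingQuot.mkAlgHom_rel ℂ (HeckeRel.braid (q := q) (v := v) i h h')
  simp only [map_mul] at this
  exact this

theorem sigma_comm (i j : ℕ) (hi : i + 1 < n) (hj : j + 1 < n) (hij : i + 1 < j) :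
    sigma q v i hi * sigma q v j hj = sigma q v j hj * sigma q v i hi := by
  have := RingQuot.mkAlgHom_rel ℂ (HeckeRel.far (q := q) (v := v) i j hi hj hij)
  simp only [map_mul] at this
  exact this

/-- Induction on elements of the Hecke algebra. -/
theorem induction_on {q : ℂ} {v : Fin m → ℂ} {p : Hecke n q v → Prop} (x : Hecke n q v)
    (algebraMap : ∀ c : ℂ, p (algebraMap ℂ _ c)) (tau : ∀ h, p (tau q v h))
    (sigma : ∀ i h, p (sigma q v i h)) (mul : ∀ a b, p a → p b → p (a * b))
    (add : ∀ a b, p a → p b → p (a + b)) : p x := by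
  obtain ⟨x, rfl⟩ := RingQuot.mkAlgHom_surjective ℂ (HeckeRel n q v) x
  induction x using FreeAlgebra.induction with
  | grade0 c => rw [AlgHom.commutes]; exact algebraMap c
  | grade1 g =>
    cases g with
    | tau h => exact tau h
    | sigma i h => exact sigma i h
  | mul a b ha hb => rw [map_mul]; exact mul _ _ ha hb
  | add a b ha hb => rw [map_add]; exact add _ _ ha hb

end Hecke

/-! ### The truncated action on all fillings. -/

section Rep

variable {q : ℂ} {v : Fin m → ℂ} {U : Type*} [AddCommGroup U] [Module ℂ U]
  (ρ : Hecke n q v →ₐ[ℂ] Module.End ℂ U)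

/-- The operator by which `σ_{i+1}` acts on `U`. -/
def repSigma (i : ℕ) (h : i + 1 < n) : Module.End ℂ U := ρ (Hecke.sigma q v i h)

theorem repSigma_sq (i : ℕ) (h : i + 1 < n) (u : U) :
    repSigma ρ i h (repSigma ρ i h u) = (q - q⁻¹) • repSigma ρ i h u + u := by
  have := congr(ρ $(Hecke.sigma_sq q v i h) u)
  simp only [map_mul, map_add, map_smul, map_one] at this
  exact this

theorem repSigma_braid (i : ℕ) (h : i + 1 + 1 < n) (h' : i + 1 < n) (u : U) :
    repSigma ρ i h' (repSigma ρ (i + 1) h (repSigma ρ i h' u)) =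
      repSigma ρ (i + 1) h (repSigma ρ i h' (repSigma ρ (i + 1) h u)) := by
  have := congr(ρ $(Hecke.sigma_braid q v i h h') u)
  simp only [map_mul] at this
  exact this

theorem repSigma_comm (i j : ℕ) (hi : i + 1 < n) (hj : j + 1 < n) (hij : i + 1 < j) (u : U) :
    repSigma ρ i hi (repSigma ρ j hj u) = repSigma ρ j hj (repSigma ρ i hi u) := by
  have := congr(ρ $(Hecke.sigma_comm q v i j hi hj hij) u)
  simp only [map_mul] at this
  exact this

variable (lam : MPartition m n)

/-- The action of `σ_{i+1}` on all fillings, cut off at the fillings with adjacent nodes. -/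
def fillSigma (i : ℕ) (h : i + 1 < n) : Module.End ℂ (Filling lam →₀ U) :=
  Finsupp.lsum ℂ fun F => Finsupp.lsingle (F.sw i h) ∘ₗ
      (cut q ((F ⟨i, by omega⟩).cont q v) ((F ⟨i + 1, h⟩).cont q v) •
        (repSigma ρ i h +
          alpha q ((F ⟨i + 1, h⟩).cont q v) ((F ⟨i, by omega⟩).cont q v) • LinearMap.id)) -
    alpha q ((F ⟨i, by omega⟩).cont q v) ((F ⟨i + 1, h⟩).cont q v) • Finsupp.lsingle F

theorem fillSigma_lsingle (i : ℕ) (h : i + 1 < n) (F G : Filling lam) (hG : F.sw i h = G) (x y : ℂ)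
    (hx : (F ⟨i, by omega⟩).cont q v = x) (hy : (F ⟨i + 1, h⟩).cont q v = y) (u : U) :
    fillSigma ρ lam i h (Finsupp.lsingle (R := ℂ) F u) =
      Finsupp.lsingle (R := ℂ) G (cut q x y • (repSigma ρ i h u + alpha q y x • u)) -
        alpha q x y • Finsupp.lsingle (R := ℂ) F u := by
  subst hG hx hy
  rw [fillSigma, Finsupp.lsingle_apply, Finsupp.lsum_single]
  rfl

/-- The action of `τ` on all fillings. -/
def fillTau (q : ℂ) (v : Fin m → ℂ) (U : Type*) [AddCommGroup U] [Module ℂ U] (lam : MPartition m n)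
    (h : 0 < n) : Module.End ℂ (Filling lam →₀ U) :=
  Finsupp.lsum ℂ fun F => (F ⟨0, h⟩).cont q v • Finsupp.lsingle F

theorem fillTau_lsingle (h : 0 < n) (F : Filling lam) (u : U) :
    fillTau q v U lam h (Finsupp.lsingle (R := ℂ) F u) =
      (F ⟨0, h⟩).cont q v • Finsupp.lsingle (R := ℂ) F u := by
  rw [fillTau, Finsupp.lsingle_apply, Finsupp.lsum_single]
  rfl

variable {lam} (hg : Generic n q v) {F : Filling lam} (hF : F.IsStandard)
include hg hF

/-- Claimed only on components of standard fillings, since contents of arbitrary fillings may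
collide. The intermediate filling need not be standard: its contents are a permutation of those of
`F`. -/
theorem fillSigma_sq (i : ℕ) (h : i + 1 < n) (u : U) :
    fillSigma ρ lam i h (fillSigma ρ lam i h (Finsupp.lsingle (R := ℂ) F u)) =
      (q - q⁻¹) • fillSigma ρ lam i h (Finsupp.lsingle (R := ℂ) F u) +
        Finsupp.lsingle (R := ℂ) F u :=
  quadratic_aux hg.q_ne_zero
    (hF.cont_ne hg ⟨i, by omega⟩ ⟨i + 1, h⟩ (by simp [Fin.lt_def]) (by simp))
    (repSigma_sq ρ i h)
    (fillSigma_lsingle ρ lam i h F (F.sw i h) rfl _ _ rfl rfl)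
    (fillSigma_lsingle ρ lam i h (F.sw i h) F (F.sw_sw i h) _ _ (by rw [F.sw_left])
      (by rw [F.sw_right])) u

theorem fill_tau_braid (h : 0 < n) (h' : 0 + 1 < n) (u : U) :
    fillTau q v U lam h (fillSigma ρ lam 0 h' (fillTau q v U lam h (fillSigma ρ lam 0 h'
      (Finsupp.lsingle (R := ℂ) F u)))) =
    fillSigma ρ lam 0 h' (fillTau q v U lam h (fillSigma ρ lam 0 h' (fillTau q v U lam h
      (Finsupp.lsingle (R := ℂ) F u)))) :=
  tau_braid_aux hg.q_ne_zero
    (hF.cont_ne hg ⟨0, h⟩ ⟨0 + 1, h'⟩ (by simp [Fin.lt_def]) (by simp))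
    (repSigma_sq ρ 0 h')
    (fillSigma_lsingle ρ lam 0 h' F (F.sw 0 h') rfl _ _ rfl rfl)
    (fillSigma_lsingle ρ lam 0 h' (F.sw 0 h') F (F.sw_sw 0 h') _ _ (by rw [F.sw_left])
      (by rw [F.sw_right]))
    (fillTau_lsingle lam h F)
    (fun u => by rw [fillTau_lsingle lam h (F.sw 0 h'), F.sw_left]) u

theorem fillSigma_braid (i : ℕ) (h : i + 1 + 1 < n) (h' : i + 1 < n) (u : U) :
    fillSigma ρ lam i h' (fillSigma ρ lam (i + 1) h (fillSigma ρ lam i h'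
      (Finsupp.lsingle (R := ℂ) F u))) =
    fillSigma ρ lam (i + 1) h (fillSigma ρ lam i h' (fillSigma ρ lam (i + 1) h
      (Finsupp.lsingle (R := ℂ) F u))) := by
  have a0 : ∀ F : Filling lam, F.sw (i + 1) h ⟨i, by omega⟩ = F ⟨i, by omega⟩ := fun F =>
    F.sw_of_ne (i + 1) h i (by omega) (by omega) (by omega)
  have a1 : ∀ F : Filling lam, F.sw (i + 1) h ⟨i + 1, h'⟩ = F ⟨i + 1 + 1, h⟩ := fun F =>
    F.sw_left (i + 1) h h'
  have a2 : ∀ F : Filling lam, F.sw (i + 1) h ⟨i + 1 + 1, h⟩ = F ⟨i + 1, h'⟩ := fun F =>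
    F.sw_right (i + 1) h
  have b0 : ∀ F : Filling lam, F.sw i h' ⟨i, by omega⟩ = F ⟨i + 1, h'⟩ := fun F =>
    F.sw_left i h' _
  have b1 : ∀ F : Filling lam, F.sw i h' ⟨i + 1, h'⟩ = F ⟨i, by omega⟩ := fun F =>
    F.sw_right i h'
  have b2 : ∀ F : Filling lam, F.sw i h' ⟨i + 1 + 1, h⟩ = F ⟨i + 1 + 1, h⟩ := fun F =>
    F.sw_of_ne i h' (i + 1 + 1) h (by omega) (by omega)
  refine braid_aux hg.q_ne_zero
    (hF.cont_ne hg ⟨i, by omega⟩ ⟨i + 1, h'⟩ (by simp [Fin.lt_def]) (by simp))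
    (hF.cont_ne hg ⟨i, by omega⟩ ⟨i + 1 + 1, h⟩ (by simp [Fin.lt_def]) (by simp))
    (hF.cont_ne hg ⟨i + 1, h'⟩ ⟨i + 1 + 1, h⟩ (by simp [Fin.lt_def]) (by simp))
    (repSigma_sq ρ i h') (repSigma_sq ρ (i + 1) h) (repSigma_braid ρ i h h')
    (fillSigma_lsingle ρ lam i h' F (F.sw i h') rfl _ _ rfl rfl)
    (fillSigma_lsingle ρ lam i h' (F.sw i h') F (F.sw_sw i h') _ _ ?_ ?_)
    (fillSigma_lsingle ρ lam i h' (F.sw (i + 1) h) ((F.sw (i + 1) h).sw i h') rfl _ _ ?_ ?_)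
    (fillSigma_lsingle ρ lam i h' ((F.sw i h').sw (i + 1) h) (((F.sw i h').sw (i + 1) h).sw i h')
      rfl _ _ ?_ ?_)
    (fillSigma_lsingle ρ lam (i + 1) h F (F.sw (i + 1) h) rfl _ _ rfl rfl)
    (fillSigma_lsingle ρ lam (i + 1) h (F.sw (i + 1) h) F (F.sw_sw (i + 1) h) _ _ ?_ ?_)
    (fillSigma_lsingle ρ lam (i + 1) h (F.sw i h') ((F.sw i h').sw (i + 1) h) rfl _ _ ?_ ?_)
    (fillSigma_lsingle ρ lam (i + 1) h ((F.sw (i + 1) h).sw i h')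
      (((F.sw i h').sw (i + 1) h).sw i h') (F.sw_braid i h' h).symm _ _ ?_ ?_) u
  all_goals simp only [a0, a1, a2, b0, b1, b2]

omit hg hF in
theorem fillSigma_comm (i j : ℕ) (hi : i + 1 < n) (hj : j + 1 < n) (hij : i + 1 < j) (u : U) :
    fillSigma ρ lam i hi (fillSigma ρ lam j hj (Finsupp.lsingle (R := ℂ) F u)) =
      fillSigma ρ lam j hj (fillSigma ρ lam i hi (Finsupp.lsingle (R := ℂ) F u)) := by
  have e1 := fillSigma_lsingle ρ lam i hi F _ rfl _ _ rfl rfl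
  have e2 := fillSigma_lsingle ρ lam j hj F _ rfl _ _ rfl rfl
  have e3 := fillSigma_lsingle ρ lam i hi (F.sw j hj) _ rfl _ _
    (by rw [F.sw_of_ne j hj i (by omega) (by omega) (by omega)])
    (by rw [F.sw_of_ne j hj (i + 1) (by omega) (by omega) (by omega)])
  have e4 := fillSigma_lsingle ρ lam j hj (F.sw i hi) _ rfl _ _
    (by rw [F.sw_of_ne i hi j (by omega) (by omega) (by omega)])
    (by rw [F.sw_of_ne i hi (j + 1) (by omega) (by omega) (by omega)])
  simp only [map_sub, map_add, map_smul, e1, e2, e3, e4, F.sw_comm i j hi hj hij,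
    repSigma_comm ρ i j hi hj hij]
  module

omit hg hF in
theorem fill_tau_comm (h : 0 < n) (i : ℕ) (hi : i + 1 < n) (hpos : 0 < i) (u : U) :
    fillTau q v U lam h (fillSigma ρ lam i hi (Finsupp.lsingle (R := ℂ) F u)) =
      fillSigma ρ lam i hi (fillTau q v U lam h (Finsupp.lsingle (R := ℂ) F u)) := by
  have e1 := fillSigma_lsingle ρ lam i hi F _ rfl _ _ rfl rfl
  have e2 := fillTau_lsingle (U := U) (q := q) (v := v) lam h F
  have e3 := fillTau_lsingle (U := U) (q := q) (v := v) lam h (F.sw i hi)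
  rw [F.sw_of_ne i hi 0 h (by omega) (by omega)] at e3
  simp only [map_sub, map_add, map_smul, e1, e2, e3]
  module

end Rep

/-! ### The representation on functions on standard tableaux. -/

section TabRep

variable {U : Type*} [AddCommGroup U] [Module ℂ U] {lam : MPartition m n}

open Classical in
/-- The embedding of `U` as the component of a filling, which is zero if the filling is not
standard. -/
def ket (U : Type*) [AddCommGroup U] [Module ℂ U] (F : Filling lam) :
    U →ₗ[ℂ] (StdTableau lam →₀ U) :=
  if h : F.IsStandard then Finsupp.lsingle ⟨F, h⟩ else 0

theorem ket_std (T : StdTableau lam) (u : U) : ket U T.1 u = Finsupp.single T u := by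
  rw [ket, dif_pos T.2]; rfl

theorem ket_of_std {F : Filling lam} (h : F.IsStandard) (u : U) :
    ket U F u = Finsupp.single ⟨F, h⟩ u := ket_std ⟨F, h⟩ u

theorem ket_of_not_std {F : Filling lam} (h : ¬ F.IsStandard) (u : U) : ket U F u = 0 := by
  rw [ket, dif_neg h]; rfl

/-- Functions on standard tableaux, as functions on all fillings. -/
def emb (U : Type*) [AddCommGroup U] [Module ℂ U] (lam : MPartition m n) :
    (StdTableau lam →₀ U) →ₗ[ℂ] (Filling lam →₀ U) :=
  Finsupp.lmapDomain U ℂ Subtype.val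

theorem emb_injective : Function.Injective (emb U lam) :=
  Finsupp.mapDomain_injective Subtype.val_injective

theorem emb_single (T : StdTableau lam) (u : U) :
    emb U lam (Finsupp.single T u) = Finsupp.lsingle (R := ℂ) T.1 u :=
  Finsupp.mapDomain_single

theorem emb_ket {F : Filling lam} (h : F.IsStandard) (u : U) :
    emb U lam (ket U F u) = Finsupp.lsingle (R := ℂ) F u := by
  rw [ket_of_std h]
  exact emb_single ⟨F, h⟩ u

variable {q : ℂ} {v : Fin m → ℂ} (ρ : Hecke n q v →ₐ[ℂ] Module.End ℂ U)

/-- The action of `σ_{i+1}` on `U`-valued functions on standard tableaux. -/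
def tabSigma (lam : MPartition m n) (i : ℕ) (h : i + 1 < n) :
    Module.End ℂ (StdTableau lam →₀ U) :=
  Finsupp.lsum ℂ fun T =>
    ket U (T.1.sw i h) ∘ₗ (repSigma ρ i h +
      alpha q ((T.1 ⟨i + 1, h⟩).cont q v) ((T.1 ⟨i, by omega⟩).cont q v) • LinearMap.id) -
    alpha q ((T.1 ⟨i, by omega⟩).cont q v) ((T.1 ⟨i + 1, h⟩).cont q v) • Finsupp.lsingle T

theorem tabSigma_single (i : ℕ) (h : i + 1 < n) (T : StdTableau lam) (u : U) :
    tabSigma ρ lam i h (Finsupp.single T u) =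
      ket U (T.1.sw i h) (repSigma ρ i h u +
        alpha q ((T.1 ⟨i + 1, h⟩).cont q v) ((T.1 ⟨i, by omega⟩).cont q v) • u) -
      alpha q ((T.1 ⟨i, by omega⟩).cont q v) ((T.1 ⟨i + 1, h⟩).cont q v) • Finsupp.single T u := by
  rw [tabSigma, Finsupp.lsum_single]
  rfl

/-- The action of `τ` on `U`-valued functions on standard tableaux. -/
def tabTau (q : ℂ) (v : Fin m → ℂ) (U : Type*) [AddCommGroup U] [Module ℂ U] (lam : MPartition m n)
    (h : 0 < n) : Module.End ℂ (StdTableau lam →₀ U) :=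
  Finsupp.lsum ℂ fun T => (T.1 ⟨0, h⟩).cont q v • Finsupp.lsingle T

theorem tabTau_single (h : 0 < n) (T : StdTableau lam) (u : U) :
    tabTau q v U lam h (Finsupp.single T u) = (T.1 ⟨0, h⟩).cont q v • Finsupp.single T u := by
  rw [tabTau, Finsupp.lsum_single]
  rfl

theorem emb_tabTau (h : 0 < n) (x : StdTableau lam →₀ U) :
    emb U lam (tabTau q v U lam h x) = fillTau q v U lam h (emb U lam x) := by
  induction x using Finsupp.induction_linear with
  | zero => simp
  | add x y hx hy => simp only [map_add, hx, hy]
  | single T u => rw [tabTau_single, map_smul, emb_single, fillTau_lsingle]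

theorem cut_eq_one (hg : Generic n q v) {F : Filling lam} (hF : F.IsStandard) (i : ℕ)
    (h : i + 1 < n) (hs : (F.sw i h).IsStandard) :
    cut q ((F ⟨i, by omega⟩).cont q v) ((F ⟨i + 1, h⟩).cont q v) = 1 := by
  rw [cut, if_neg]
  exact fun hc => hF.not_sw_of_cont hg i h hc hs

theorem cut_eq_zero (hg : Generic n q v) {F : Filling lam} (hF : F.IsStandard) (i : ℕ)
    (h : i + 1 < n) (hs : ¬ (F.sw i h).IsStandard) :
    cut q ((F ⟨i, by omega⟩).cont q v) ((F ⟨i + 1, h⟩).cont q v) = 0 := by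
  rw [cut, if_pos]
  exact hF.cont_of_not_sw hg i h hs

/-- On standard fillings `cut` is exactly the indicator that the exchanged filling is standard. So
the standard components are stable inside all fillings, and relations checked there descend. -/
theorem emb_tabSigma (hg : Generic n q v) (i : ℕ) (h : i + 1 < n) (x : StdTableau lam →₀ U) :
    emb U lam (tabSigma ρ lam i h x) = fillSigma ρ lam i h (emb U lam x) := by
  induction x using Finsupp.induction_linear with
  | zero => simp
  | add x y hx hy => simp only [map_add, hx, hy]
  | single T u =>
    rw [tabSigma_single, map_sub, map_smul, emb_single, fillSigma_lsingle ρ lam i h T.1 _ rfl _ _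
      rfl rfl]
    congr 1
    by_cases hs : (T.1.sw i h).IsStandard
    · rw [cut_eq_one hg T.2 i h hs, emb_ket hs, one_smul]
    · rw [cut_eq_zero hg T.2 i h hs, ket_of_not_std hs, zero_smul, map_zero, map_zero]

theorem list_prod_apply {R M ι : Type*} [CommRing R] [AddCommGroup M] [Module R M]
    (A : Module.End R M) (c : R) (x : M) (hA : A x = c • x) (d : ι → R) (l : List ι) :
    (l.map fun k => A - algebraMap R _ (d k)).prod x = (l.map fun k => c - d k).prod • x := by
  induction l with
  | nil => simp
  | cons k l ih =>
    rw [List.map_cons, List.prod_cons, List.map_cons, List.prod_cons, Module.End.mul_apply, ih,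
      map_smul, LinearMap.sub_apply, hA, Module.algebraMap_end_apply]
    module

/-- The action of a generator of the Hecke algebra on `U`-valued functions on standard
tableaux. -/
def tabGen (lam : MPartition m n) : HGen n → Module.End ℂ (StdTableau lam →₀ U)
  | .tau h => tabTau q v U lam h
  | .sigma i h => tabSigma ρ lam i h

theorem tab_ext {A B : Module.End ℂ (StdTableau lam →₀ U)}
    (h : ∀ T u, emb U lam (A (Finsupp.single T u)) = emb U lam (B (Finsupp.single T u))) :
    A = B :=
  Finsupp.lhom_ext fun T u => emb_injective (h T u)

theorem tabGen_rel (hg : Generic n q v) {a b : FreeAlgebra ℂ (HGen n)} (h : HeckeRel n q v a b) :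
    FreeAlgebra.lift ℂ (tabGen ρ lam) a = FreeAlgebra.lift ℂ (tabGen ρ lam) b := by
  have eσ : ∀ i h, FreeAlgebra.lift ℂ (tabGen ρ lam) (fSigma i h) = tabSigma ρ lam i h :=
    fun i h => FreeAlgebra.lift_ι_apply _ _
  have eτ : ∀ h, FreeAlgebra.lift ℂ (tabGen ρ lam) (fTau h) = tabTau q v U lam h :=
    fun h => FreeAlgebra.lift_ι_apply _ _
  cases h with
  | braid i h h' =>
    refine tab_ext fun T u => ?_
    simp only [map_mul, eσ, Module.End.mul_apply, emb_tabSigma ρ hg, emb_single]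
    exact fillSigma_braid ρ hg T.2 i h h' u
  | far i j hi hj hij =>
    refine tab_ext fun T u => ?_
    simp only [map_mul, eσ, Module.End.mul_apply, emb_tabSigma ρ hg, emb_single]
    exact fillSigma_comm ρ i j hi hj hij u
  | tau_braid h h' =>
    refine tab_ext fun T u => ?_
    simp only [map_mul, eσ, eτ, Module.End.mul_apply, emb_tabSigma ρ hg, emb_tabTau, emb_single]
    exact fill_tau_braid ρ hg T.2 h h' u
  | tau_far h i hi hpos =>
    refine tab_ext fun T u => ?_
    simp only [map_mul, eσ, eτ, Module.End.mul_apply, emb_tabSigma ρ hg, emb_tabTau, emb_single]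
    exact fill_tau_comm ρ h i hi hpos u
  | quadratic i hi =>
    refine tab_ext fun T u => ?_
    simp only [map_mul, map_add, map_smul, map_one, eσ, Module.End.mul_apply, LinearMap.add_apply,
      LinearMap.smul_apply, Module.End.one_apply, emb_tabSigma ρ hg, emb_single]
    exact fillSigma_sq ρ hg T.2 i hi u
  | cyclotomic h =>
    refine Finsupp.lhom_ext fun T u => ?_
    have := list_prod_apply (tabTau q v U lam h) _ _ (tabTau_single h T u) v (List.finRange m)
    rw [map_list_prod, List.ofFn_eq_map, List.map_map, map_zero, LinearMap.zero_apply]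
    simp only [Function.comp_def, map_sub, eτ, AlgHom.commutes]
    rw [this, List.prod_eq_zero, zero_smul]
    -- The smallest number sits in a corner, so its content is the parameter of its diagram and
    -- kills that factor.
    refine List.mem_map.2 ⟨(T.1 ⟨0, h⟩).pos, List.mem_finRange _, ?_⟩
    rw [T.2.content_zero, sub_self]

/-- The representation of the Hecke algebra on `U`-valued functions on standard tableaux. -/
def tabRep (hg : Generic n q v) (lam : MPartition m n) :
    Hecke n q v →ₐ[ℂ] Module.End ℂ (StdTableau lam →₀ U) :=
  RingQuot.liftAlgHom ℂ ⟨FreeAlgebra.lift ℂ (tabGen ρ lam), fun _ _ h => tabGen_rel ρ hg h⟩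

theorem tabRep_tau (hg : Generic n q v) (h : 0 < n) :
    tabRep ρ hg lam (Hecke.tau q v h) = tabTau q v U lam h := by
  rw [tabRep, Hecke.tau, RingQuot.liftAlgHom_mkAlgHom_apply]
  exact FreeAlgebra.lift_ι_apply _ _

theorem tabRep_sigma (hg : Generic n q v) (i : ℕ) (h : i + 1 < n) :
    tabRep ρ hg lam (Hecke.sigma q v i h) = tabSigma ρ lam i h := by
  rw [tabRep, Hecke.sigma, RingQuot.liftAlgHom_mkAlgHom_apply]
  exact FreeAlgebra.lift_ι_apply _ _

end TabRep

/-! ### The vacuum character. -/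

section Trivial

variable {q : ℂ} {v : Fin m → ℂ} [NeZero m]

/-- The values of the trivial character on generators. -/
def trivGen (q : ℂ) (v : Fin m → ℂ) : HGen n → ℂ
  | .tau _ => v 0
  | .sigma _ _ => q

theorem trivGen_rel (hq : q ≠ 0) {a b : FreeAlgebra ℂ (HGen n)} (h : HeckeRel n q v a b) :
    FreeAlgebra.lift ℂ (trivGen q v) a = FreeAlgebra.lift ℂ (trivGen q v) b := by
  have eσ : ∀ i h, FreeAlgebra.lift ℂ (trivGen (n := n) q v) (fSigma i h) = q :=
    fun i h => FreeAlgebra.lift_ι_apply _ _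
  have eτ : ∀ h, FreeAlgebra.lift ℂ (trivGen (n := n) q v) (fTau h) = v 0 :=
    fun h => FreeAlgebra.lift_ι_apply _ _
  cases h with
  | braid i h h' => simp only [map_mul, eσ]
  | far i j hi hj hij => simp only [map_mul, eσ]
  | tau_braid h h' => simp only [map_mul, eσ, eτ]; ring
  | tau_far h i hi hpos => simp only [map_mul, eσ, eτ]; ring
  | quadratic i hi =>
    simp only [map_mul, map_add, map_smul, map_one, eσ, smul_eq_mul]
    field_simp
    ring
  | cyclotomic h =>
    rw [map_list_prod, List.ofFn_eq_map, List.map_map, map_zero]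
    refine List.prod_eq_zero (List.mem_map.2 ⟨0, List.mem_finRange _, ?_⟩)
    simp only [Function.comp_apply, map_sub, eτ, AlgHom.commutes, Algebra.algebraMap_self,
      RingHom.id_apply, sub_self]

/-- The character of the Hecke algebra with `τ ↦ v_1`, `σ_i ↦ q`. -/
def trivChar (hq : q ≠ 0) : Hecke n q v →ₐ[ℂ] ℂ :=
  RingQuot.liftAlgHom ℂ ⟨FreeAlgebra.lift ℂ (trivGen q v), fun _ _ h => trivGen_rel hq h⟩

theorem trivChar_tau (hq : q ≠ 0) (h : 0 < n) : trivChar hq (Hecke.tau q v h) = v 0 := by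
  rw [trivChar, Hecke.tau, RingQuot.liftAlgHom_mkAlgHom_apply]
  exact FreeAlgebra.lift_ι_apply _ _

theorem trivChar_sigma (hq : q ≠ 0) (i : ℕ) (h : i + 1 < n) :
    trivChar hq (Hecke.sigma q v i h) = q := by
  rw [trivChar, Hecke.sigma, RingQuot.liftAlgHom_mkAlgHom_apply]
  exact FreeAlgebra.lift_ι_apply _ _

/-- The multiple of the character `τ ↦ v_1`, `σ_i ↦ q` on a vector space. -/
def trivRep (hq : q ≠ 0) (U : Type*) [AddCommGroup U] [Module ℂ U] :
    Hecke n q v →ₐ[ℂ] Module.End ℂ U :=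
  (Algebra.ofId ℂ (Module.End ℂ U)).comp (trivChar hq)

theorem trivRep_apply (hq : q ≠ 0) {U : Type*} [AddCommGroup U] [Module ℂ U] (x : Hecke n q v)
    (u : U) : trivRep hq U x u = trivChar hq x • u := rfl

theorem repSigma_trivRep (hq : q ≠ 0) {U : Type*} [AddCommGroup U] [Module ℂ U] (i : ℕ)
    (h : i + 1 < n) (u : U) : repSigma (trivRep (v := v) hq U) i h u = q • u := by
  rw [repSigma, trivRep_apply, trivChar_sigma]

end Trivial

/-! ### Baxterized generators and the gauge that trivializes them. -/

section Gauge

variable {q : ℂ} {v : Fin m → ℂ} {U : Type*} [AddCommGroup U] [Module ℂ U]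
  (ρ : Hecke n q v →ₐ[ℂ] Module.End ℂ U)

/-- The normalized baxterized generator
`(σ_i + (q-q⁻¹) x / (y - x)) / (q + (q-q⁻¹) x / (y - x))`. -/
def bax (i : ℕ) (h : i + 1 < n) (x y : ℂ) : Module.End ℂ U :=
  (q + alpha q y x)⁻¹ • (repSigma ρ i h + alpha q y x • 1)

theorem add_alpha_mul {q x y : ℂ} (hq : q ≠ 0) (h : x ≠ y) :
    (q + alpha q y x) * (q + alpha q x y) = 1 + alpha q x y * alpha q y x := by
  have a := alpha_add_alpha (q := q) h
  have : q * q⁻¹ = 1 := mul_inv_cancel₀ hq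
  linear_combination q * a + this

theorem one_add_alpha_ne_zero {q x y : ℂ} (hq : q ≠ 0) (h : x ≠ y) (hc : cut q x y = 1) :
    1 + alpha q x y * alpha q y x ≠ 0 := by
  have h1 : ¬ (y = q ^ 2 * x ∨ x = q ^ 2 * y) := by
    intro h1
    rw [cut, if_pos h1] at hc
    exact zero_ne_one hc
  rw [not_or] at h1
  rw [one_add_alpha_mul hq h]
  have := sub_ne_zero.2 h
  exact div_ne_zero (mul_ne_zero (sub_ne_zero.2 (Ne.symm h1.1)) (sub_ne_zero.2 (Ne.symm h1.2)))
    (mul_ne_zero (neg_ne_zero.2 (pow_ne_zero _ hq)) (pow_ne_zero _ this))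

theorem add_alpha_ne_zero {q x y : ℂ} (hq : q ≠ 0) (h : x ≠ y) (hc : cut q x y = 1) :
    q + alpha q y x ≠ 0 := by
  have := one_add_alpha_ne_zero hq h hc
  rw [← add_alpha_mul hq h] at this
  exact left_ne_zero_of_mul this

/-- Unitarity: the quadratic relation makes the unnormalized product scalar, and since `q` is a root
of that relation the normalizing factors have the same product. -/
theorem bax_mul_bax (hq : q ≠ 0) (i : ℕ) (h : i + 1 < n) {x y : ℂ} (hxy : x ≠ y)
    (hc : cut q x y = 1) : bax ρ i h y x * bax ρ i h x y = 1 := by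
  have h1 := one_add_alpha_ne_zero hq hxy hc
  have h2 := add_alpha_mul hq hxy
  have a := alpha_add_alpha (q := q) hxy
  have h3 : (repSigma ρ i h + alpha q x y • 1) * (repSigma ρ i h + alpha q y x • 1) =
      (1 + alpha q x y * alpha q y x) • (1 : Module.End ℂ U) := by
    ext u
    simp only [Module.End.mul_apply, LinearMap.add_apply, LinearMap.smul_apply,
      Module.End.one_apply, map_add, map_smul, repSigma_sq]
    match_scalars
    · linear_combination a
    · ring
  rw [bax, bax, smul_mul_smul_comm, h3, smul_smul, ← mul_inv, mul_comm (q + alpha q x y), h2,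
    inv_mul_cancel₀ h1, one_smul]

theorem bax_comm (i j : ℕ) (hi : i + 1 < n) (hj : j + 1 < n) (hij : i + 1 < j) (x y z w : ℂ) :
    bax ρ i hi x y * bax ρ j hj z w = bax ρ j hj z w * bax ρ i hi x y := by
  ext u
  simp only [bax, Module.End.mul_apply, LinearMap.add_apply, LinearMap.smul_apply,
      Module.End.one_apply, map_add, map_smul, repSigma_comm ρ i j hi hj hij]
  module

theorem bax_braid (i : ℕ) (h : i + 1 + 1 < n) (h' : i + 1 < n) {x y z : ℂ}
    (hxy : x ≠ y) (hxz : x ≠ z) (hyz : y ≠ z) :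
    bax ρ i h' y z * bax ρ (i + 1) h x z * bax ρ i h' x y =
      bax ρ (i + 1) h x y * bax ρ i h' x z * bax ρ (i + 1) h y z := by
  have b := alpha_braid (q := q) hyz.symm hxz.symm hxy.symm
  simp only [bax, smul_mul_smul_comm]
  rw [show (q + alpha q z y)⁻¹ * (q + alpha q z x)⁻¹ * (q + alpha q y x)⁻¹ =
    (q + alpha q y x)⁻¹ * (q + alpha q z x)⁻¹ * (q + alpha q z y)⁻¹ by ring]
  congr 1
  ext u
  simp only [Module.End.mul_apply, LinearMap.add_apply, LinearMap.smul_apply,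
      Module.End.one_apply, map_add, map_smul, repSigma_sq, repSigma_braid ρ i h h']
  generalize alpha q z y = t at *
  generalize alpha q z x = r at *
  generalize alpha q y x = p at *
  match_scalars <;> first | ring1 | linear_combination b | linear_combination -b

variable {lam : MPartition m n}

/-- The baxterized generator with spectral parameters the contents of a filling. -/
def fillBax (i : ℕ) (h : i + 1 < n) (T : Filling lam) : Module.End ℂ U :=
  bax ρ i h ((T ⟨i, by omega⟩).cont q v) ((T ⟨i + 1, h⟩).cont q v)

/-- The standard fillings that agree with `T₀` after place `k`, and in which the node that `T₀`
puts at place `k` is not before place `j`. -/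
structure Stage (T₀ : Filling lam) (k : ℕ) (hk : k < n) (j : ℕ) (T : Filling lam) : Prop where
  std : T.IsStandard
  agree : ∀ p : Fin n, k < p → T p = T₀ p
  place : ∀ p : Fin n, (p : ℕ) < j → T p ≠ T₀ ⟨k, hk⟩

/-- A gauge trivializing the baxterized generators on a set of fillings. -/
structure IsGauge (S : Filling lam → Prop) (k : ℕ) (g : Filling lam → Module.End ℂ U) : Prop where
  isUnit : ∀ T, S T → IsUnit (g T)
  flat : ∀ (T : Filling lam) (i : ℕ) (h : i + 1 < n), i + 1 ≤ k → S T → S (T.sw i h) →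
    g (T.sw i h) = fillBax ρ i h T * g T

/-- Nothing obstructs moving the marked node `T₀ k` one place later: a later node blocking it would
also come after it in `T₀`, hence at a place beyond `k`, where `T` agrees with `T₀`. -/
theorem Stage.sw {T₀ T : Filling lam} (h₀ : T₀.IsStandard) {k : ℕ} {hk : k < n} {j : ℕ}
    (hj : j + 1 < n) (hjk : j < k) (hT : Stage T₀ k hk j T) (hx : T ⟨j, by omega⟩ = T₀ ⟨k, hk⟩) :
    Stage T₀ k hk (j + 1) (T.sw j hj) where
  std := by
    by_contra hs
    obtain ⟨hpos, hrc⟩ := hT.std.adjacent_of_not_sw j hj hs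
    obtain ⟨l, hl⟩ := T₀.surjective (T ⟨j + 1, hj⟩)
    rw [← hl, hx] at hpos hrc
    have h1 : (⟨k, hk⟩ : Fin n) ≤ l := h₀.le_of_le hpos (by omega) (by omega)
    rcases h1.lt_or_eq with h1 | h1
    · rw [← hT.agree l h1] at hl
      have := T.injective hl
      subst this
      simp only [Fin.lt_def] at h1
      omega
    · subst h1
      omega
  agree p hp := by
    rw [← hT.agree p hp]
    exact T.sw_of_ne j hj p p.2 (by omega) (by omega)
  place p hp := by
    rcases Nat.lt_succ_iff_lt_or_eq.1 hp with h1 | h1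
    · rw [show T.sw j hj p = T p from T.sw_of_ne j hj p p.2 (by omega) (by omega)]
      exact hT.place p h1
    · rw [show p = ⟨j, by omega⟩ from Fin.ext h1, T.sw_left, ← hx]
      exact fun h => by simpa [Fin.ext_iff] using T.injective h

theorem Stage.mono {T₀ T : Filling lam} {k : ℕ} {hk : k < n} {j j' : ℕ} (h : j' ≤ j)
    (hT : Stage T₀ k hk j T) : Stage T₀ k hk j' T :=
  ⟨hT.std, hT.agree, fun p hp => hT.place p (by omega)⟩

theorem Stage.succ {T₀ T : Filling lam} {k : ℕ} {hk : k < n} {j : ℕ} (hj : j < n)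
    (hT : Stage T₀ k hk j T) (hx : T ⟨j, hj⟩ ≠ T₀ ⟨k, hk⟩) : Stage T₀ k hk (j + 1) T where
  std := hT.std
  agree := hT.agree
  place p hp := by
    rcases Nat.lt_succ_iff_lt_or_eq.1 hp with h1 | h1
    · exact hT.place p h1
    · obtain rfl : p = ⟨j, hj⟩ := Fin.ext h1
      exact hx

/-- When the marked node can no longer be earlier than place `k + 1` it is pinned there, which
connects the last stage for `k + 1` to the first stage for `k`. -/
theorem Stage.pred {T₀ T : Filling lam} {k : ℕ} {hk : k + 1 < n}
    (hT : Stage T₀ (k + 1) hk (k + 1) T) :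
    Stage T₀ k (by omega) 0 T ∧ T ⟨k + 1, hk⟩ = T₀ ⟨k + 1, hk⟩ := by
  have h1 : T ⟨k + 1, hk⟩ = T₀ ⟨k + 1, hk⟩ := by
    obtain ⟨p, hp⟩ := T.surjective (T₀ ⟨k + 1, hk⟩)
    have h2 : ¬ (p : ℕ) < k + 1 := fun h => hT.place p h hp
    have h3 : ¬ k + 1 < (p : ℕ) := fun h => by
      rw [hT.agree p h] at hp
      have := T₀.injective hp
      subst this
      simp at h
    obtain rfl : p = ⟨k + 1, hk⟩ := Fin.ext (by simp only; omega)
    exact hp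
  refine ⟨⟨hT.std, fun p hp => ?_, fun p hp => absurd hp (by omega)⟩, h1⟩
  rcases Nat.lt_or_ge (k + 1) p with h | h
  · exact hT.agree p h
  · obtain rfl : p = ⟨k + 1, hk⟩ := Fin.ext (by simp only; omega)
    exact h1

theorem fillBax_sw_mul (hg : Generic n q v) {T : Filling lam} (i : ℕ) (h : i + 1 < n)
    (hT : T.IsStandard) (hs : (T.sw i h).IsStandard) :
    fillBax ρ i h (T.sw i h) * fillBax ρ i h T = 1 := by
  rw [fillBax, fillBax, T.sw_left, T.sw_right]
  exact bax_mul_bax ρ hg.q_ne_zero i h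
    (hT.cont_ne hg ⟨i, by omega⟩ ⟨i + 1, h⟩ (by simp [Fin.lt_def]) (by simp))
    (cut_eq_one hg hT i h hs)

theorem fillBax_mul_sw (hg : Generic n q v) {T : Filling lam} (i : ℕ) (h : i + 1 < n)
    (hT : T.IsStandard) (hs : (T.sw i h).IsStandard) :
    fillBax ρ i h T * fillBax ρ i h (T.sw i h) = 1 := by
  simpa using fillBax_sw_mul ρ hg i h hs (by simpa using hT)

theorem isUnit_fillBax (hg : Generic n q v) {T : Filling lam} (i : ℕ) (h : i + 1 < n)
    (hT : T.IsStandard) (hs : (T.sw i h).IsStandard) : IsUnit (fillBax ρ i h T) :=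
  ⟨⟨_, _, fillBax_mul_sw ρ hg i h hT hs, fillBax_sw_mul ρ hg i h hT hs⟩, rfl⟩

theorem fillBax_comm {T : Filling lam} (i j : ℕ) (hi : i + 1 < n) (hj : j + 1 < n)
    (hij : i + 1 < j ∨ j + 1 < i) :
    fillBax ρ i hi (T.sw j hj) * fillBax ρ j hj T =
      fillBax ρ j hj (T.sw i hi) * fillBax ρ i hi T := by
  unfold fillBax
  rw [T.sw_of_ne i hi j (by omega) (by omega) (by omega),
    T.sw_of_ne i hi (j + 1) (by omega) (by omega) (by omega),
    T.sw_of_ne j hj i (by omega) (by omega) (by omega),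
    T.sw_of_ne j hj (i + 1) (by omega) (by omega) (by omega)]
  rcases hij with h | h
  · exact bax_comm ρ i j hi hj h _ _ _ _
  · exact (bax_comm ρ j i hj hi h _ _ _ _).symm

theorem fillBax_braid (hg : Generic n q v) {F : Filling lam} (hF : F.IsStandard) (i : ℕ)
    (h : i + 1 + 1 < n) (h' : i + 1 < n) :
    fillBax ρ i h' ((F.sw i h').sw (i + 1) h) * fillBax ρ (i + 1) h (F.sw i h') *
      fillBax ρ i h' F =
    fillBax ρ (i + 1) h ((F.sw (i + 1) h).sw i h') * fillBax ρ i h' (F.sw (i + 1) h) *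
      fillBax ρ (i + 1) h F := by
  have a0 : ∀ F : Filling lam, F.sw (i + 1) h ⟨i, by omega⟩ = F ⟨i, by omega⟩ := fun F =>
    F.sw_of_ne (i + 1) h i (by omega) (by omega) (by omega)
  have a1 : ∀ F : Filling lam, F.sw (i + 1) h ⟨i + 1, h'⟩ = F ⟨i + 1 + 1, h⟩ := fun F =>
    F.sw_left (i + 1) h h'
  have a2 : ∀ F : Filling lam, F.sw (i + 1) h ⟨i + 1 + 1, h⟩ = F ⟨i + 1, h'⟩ := fun F =>
    F.sw_right (i + 1) h
  have b0 : ∀ F : Filling lam, F.sw i h' ⟨i, by omega⟩ = F ⟨i + 1, h'⟩ := fun F =>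
    F.sw_left i h' _
  have b1 : ∀ F : Filling lam, F.sw i h' ⟨i + 1, h'⟩ = F ⟨i, by omega⟩ := fun F =>
    F.sw_right i h'
  have b2 : ∀ F : Filling lam, F.sw i h' ⟨i + 1 + 1, h⟩ = F ⟨i + 1 + 1, h⟩ := fun F =>
    F.sw_of_ne i h' (i + 1 + 1) h (by omega) (by omega)
  simp only [fillBax, a0, a1, a2, b0, b1, b2]
  exact bax_braid ρ i h h'
    (hF.cont_ne hg ⟨i, by omega⟩ ⟨i + 1, h'⟩ (by simp [Fin.lt_def]) (by simp))
    (hF.cont_ne hg ⟨i, by omega⟩ ⟨i + 1 + 1, h⟩ (by simp [Fin.lt_def]) (by simp))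
    (hF.cont_ne hg ⟨i + 1, h'⟩ ⟨i + 1 + 1, h⟩ (by simp [Fin.lt_def]) (by simp))

-- Each new filling has the marked node at place `j`. Moving it to `j + 1` lands in the old stage,
-- and the gauge is transported back along this edge. Compatibility with an edge `i` is unitarity
-- for `i = j`, commutation for distant `i`, and the braid hexagon for `i = j + 1`.
open Classical in
theorem IsGauge.step (hg : Generic n q v) {T₀ : Filling lam} (h₀ : T₀.IsStandard) {k : ℕ}
    {hk : k < n} {j : ℕ} (hjk : j < k) {g : Filling lam → Module.End ℂ U}
    (hgauge : IsGauge ρ (Stage T₀ k hk (j + 1)) k g) :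
    IsGauge ρ (Stage T₀ k hk j) k fun T => if T ⟨j, by omega⟩ = T₀ ⟨k, hk⟩ then
      fillBax ρ j (by omega) (T.sw j (by omega)) * g (T.sw j (by omega)) else g T where
  isUnit T hT := by
    have hj : j + 1 < n := by omega
    split_ifs with hx
    · have h1 := hT.sw h₀ hj hjk hx
      exact (isUnit_fillBax ρ hg j hj h1.std (by simpa using hT.std)).mul (hgauge.isUnit _ h1)
    · exact hgauge.isUnit _ (hT.succ _ hx)
  flat T i hi hik hT hS := by
    have hj : j + 1 < n := by omega
    by_cases hx : T ⟨j, by omega⟩ = T₀ ⟨k, hk⟩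
    · have h1 := hT.sw h₀ hj hjk hx
      rw [if_pos hx]
      rcases lt_trichotomy i j with hij | rfl | hij
      · rcases Nat.lt_or_eq_of_le (show i + 1 ≤ j by omega) with hij' | rfl
        · have hx' : T.sw i hi ⟨j, by omega⟩ = T₀ ⟨k, hk⟩ := by
            rw [T.sw_of_ne i hi j (by omega) (by omega) (by omega), hx]
          have h2 := hS.sw h₀ hj hjk hx'
          have e := T.sw_comm i j hi hj hij'
          have fl := hgauge.flat (T.sw j hj) i hi hik h1 (e ▸ h2)
          have c := fillBax_comm ρ (T := T.sw j hj) j i hj hi (Or.inr hij')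
          rw [T.sw_sw, ← e] at c
          rw [if_pos hx', e, fl, ← mul_assoc, ← mul_assoc, ← e, c]
        -- The case `i + 1 = j` cannot occur: the exchange would put the marked node before place
        -- `j`.
        · exact absurd (by rw [T.sw_left, hx]) (hS.place ⟨i, by omega⟩ (by simp))
      · have hx' : T.sw i hi ⟨i, by omega⟩ ≠ T₀ ⟨k, hk⟩ := by
          rw [T.sw_left, ← hx]
          exact fun h => by simpa [Fin.ext_iff] using T.injective h
        rw [if_neg hx', ← mul_assoc, fillBax_mul_sw ρ hg i hi hT.std hS.std, one_mul]
      · have hx' : T.sw i hi ⟨j, by omega⟩ = T₀ ⟨k, hk⟩ := by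
          rw [T.sw_of_ne i hi j (by omega) (by omega) (by omega), hx]
        have h2 := hS.sw h₀ hj hjk hx'
        rw [if_pos hx']
        rcases Nat.lt_or_eq_of_le (show j + 1 ≤ i by omega) with hij' | rfl
        · have e := T.sw_comm j i hj hi hij'
          have fl := hgauge.flat (T.sw j hj) i hi hik h1 (e ▸ h2)
          have c := fillBax_comm ρ (T := T.sw j hj) j i hj hi (Or.inl hij')
          rw [T.sw_sw, e] at c
          rw [← e, fl, ← mul_assoc, ← mul_assoc, e, c]
        · have h3 : Stage T₀ k hk (j + 1) ((T.sw j hj).sw (j + 1) hi) :=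
            (h1.sw h₀ hi (by omega) (by rw [T.sw_right, hx])).mono (by omega)
          have h4 : Stage T₀ k hk (j + 1) (((T.sw (j + 1) hi).sw j hj).sw (j + 1) hi) :=
            (h2.sw h₀ hi (by omega) (by rw [Filling.sw_right, hx'])).mono (by omega)
          have b := T.sw_braid j hj hi
          have f1 := hgauge.flat _ (j + 1) hi hik h2 h4
          have f2 := hgauge.flat _ (j + 1) hi hik h1 h3
          have f3 := hgauge.flat _ j hj (by omega) h3 (b ▸ h4)
          have c := fillBax_braid ρ hg hT.std j hi hj
          have u1 := isUnit_fillBax ρ hg (j + 1) hi h2.std h4.std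
          have u2 := isUnit_fillBax ρ hg j hj hS.std h2.std
          have m1 := fillBax_mul_sw ρ hg j hj hS.std h2.std
          have m2 := fillBax_mul_sw ρ hg j hj hT.std h1.std
          -- Five edges of the hexagon are known to be compatible: three from the old stage and two
          -- by the definition of the transport. The braid identity yields the sixth after
          -- cancelling invertible factors.
          rw [b, f1, f2] at f3
          refine (u1.mul u2).mul_left_cancel ?_
          rw [mul_assoc, ← mul_assoc (fillBax ρ j hj (T.sw (j + 1) hi)), m1, one_mul, f3,
            ← mul_assoc _ (fillBax ρ (j + 1) hi T), ← c, mul_assoc _ (fillBax ρ j hj T),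
            ← mul_assoc (fillBax ρ j hj T), m2, one_mul, mul_assoc]
    · rw [if_neg hx]
      by_cases hx' : T.sw i hi ⟨j, by omega⟩ = T₀ ⟨k, hk⟩
      · have : i = j := by
          by_contra hne
          by_cases hij : j = i + 1
          · subst hij
            rw [T.sw_right] at hx'
            exact hT.place _ (by simp) hx'
          · rw [T.sw_of_ne i hi j (by omega) (by omega) (by omega)] at hx'
            exact hx hx'
        subst this
        rw [if_pos hx', T.sw_sw]
      · rw [if_neg hx']
        exact hgauge.flat T i hi hik (hT.succ _ hx) (hS.succ _ hx')

/-- Double induction: `k` grows, freeing more places from agreement with `T₀`, and for each `k` the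
earliest place allowed to the marked node decreases from `k` to `0`. -/
theorem exists_isGauge_stage (hg : Generic n q v) {T₀ : Filling lam} (h₀ : T₀.IsStandard) {k : ℕ}
    (hk : k < n) : ∃ g, IsGauge ρ (Stage T₀ k hk 0) k g := by
  have down : ∀ (k : ℕ) (hk : k < n), (∃ g, IsGauge ρ (Stage T₀ k hk k) k g) →
      ∃ g, IsGauge ρ (Stage T₀ k hk 0) k g := by
    intro k hk hg'
    refine Nat.decreasingInduction' (P := fun j => ∃ g, IsGauge ρ (Stage T₀ k hk j) k g)
      (fun j hj _ ⟨g, h⟩ => ⟨_, h.step ρ hg h₀ hj⟩) (Nat.zero_le k) hg'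
  induction k with
  | zero => exact ⟨fun _ => 1, fun _ _ => isUnit_one, fun _ _ _ h => absurd h (by omega)⟩
  | succ k ih =>
    obtain ⟨g, hgauge⟩ := ih (by omega)
    refine down _ hk ⟨g, fun T hT => hgauge.isUnit T hT.pred.1, fun T i h hik hT hS => ?_⟩
    rcases Nat.lt_or_eq_of_le hik with hi | hi
    · exact hgauge.flat T i h (by omega) hT.pred.1 hS.pred.1
    -- The new edge would move the pinned node, so no two members of this stage are joined by it.
    · obtain rfl : i = k := by omega
      have h1 := hT.pred.2
      have h2 := hS.pred.2
      rw [T.sw_right, ← h1] at h2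
      exact absurd (T.injective h2) (by simp [Fin.ext_iff])

theorem exists_isGauge (hg : Generic n q v) (lam : MPartition m n) :
    ∃ g : Filling lam → Module.End ℂ U, IsGauge ρ Filling.IsStandard n g := by
  by_cases hne : ∃ T₀ : Filling lam, T₀.IsStandard
  · obtain ⟨T₀, h₀⟩ := hne
    rcases Nat.eq_zero_or_pos n with rfl | hn
    · exact ⟨fun _ => 1, fun _ _ => isUnit_one, fun _ _ h => absurd h (by omega)⟩
    · obtain ⟨g, hgauge⟩ := exists_isGauge_stage ρ hg h₀ (k := n - 1) (by omega)
      have key : ∀ T : Filling lam, T.IsStandard → Stage T₀ (n - 1) (by omega) 0 T := fun T hT =>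
        ⟨hT, fun p hp => absurd hp (by omega), fun p hp => absurd hp (by omega)⟩
      exact ⟨g, fun T hT => hgauge.isUnit T (key T hT), fun T i h _ hT hS =>
        hgauge.flat T i h (by omega) (key T hT) (key _ hS)⟩
  · exact ⟨fun _ => 1, fun _ _ => isUnit_one, fun T _ _ _ hT => absurd ⟨T, hT⟩ hne⟩

end Gauge

/-! ### Independence of the inner representation. -/

section Intertwine

variable {q : ℂ} {v : Fin m → ℂ}

/-- A linear map commuting with the generators of the Hecke algebra commutes with its action. -/
theorem intertwine {U W : Type*} [AddCommGroup U] [Module ℂ U] [AddCommGroup W] [Module ℂ W]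
    (ρ : Hecke n q v →ₐ[ℂ] Module.End ℂ U) (ρ' : Hecke n q v →ₐ[ℂ] Module.End ℂ W) (f : U →ₗ[ℂ] W)
    (hτ : ∀ h u, f (ρ (Hecke.tau q v h) u) = ρ' (Hecke.tau q v h) (f u))
    (hσ : ∀ i h u, f (ρ (Hecke.sigma q v i h) u) = ρ' (Hecke.sigma q v i h) (f u))
    (x : Hecke n q v) (u : U) : f (ρ x u) = ρ' x (f u) := by
  induction x using Hecke.induction_on generalizing u with
  | algebraMap c => simp only [AlgHom.commutes, Module.algebraMap_end_apply, map_smul]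
  | tau h => exact hτ h u
  | sigma i h => exact hσ i h u
  | mul a b ha hb => simp only [map_mul, Module.End.mul_apply, ha, hb]
  | add a b ha hb => simp only [map_add, LinearMap.add_apply, ha, hb]

end Intertwine

section GaugeEquiv

variable {q : ℂ} {v : Fin m → ℂ} {U : Type*} [AddCommGroup U] [Module ℂ U] {lam : MPartition m n}

/-- Applying an operator depending on the tableau. -/
def twist (g : Filling lam → Module.End ℂ U) : Module.End ℂ (StdTableau lam →₀ U) :=
  Finsupp.lsum ℂ fun T => Finsupp.lsingle T ∘ₗ g T.1

theorem twist_single (g : Filling lam → Module.End ℂ U) (T : StdTableau lam) (u : U) :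
    twist g (Finsupp.single T u) = Finsupp.single T (g T.1 u) := by
  rw [twist, Finsupp.lsum_single]
  rfl

theorem twist_ket (g : Filling lam → Module.End ℂ U) (F : Filling lam) (u : U) :
    twist g (ket U F u) = ket U F (g F u) := by
  by_cases h : F.IsStandard
  · obtain ⟨T, rfl⟩ : ∃ T : StdTableau lam, T.1 = F := ⟨⟨F, h⟩, rfl⟩
    rw [ket_std, ket_std, twist_single]
  · rw [ket_of_not_std h, ket_of_not_std h, map_zero]

theorem twist_bijective {g : Filling lam → Module.End ℂ U}
    (hg : ∀ T : Filling lam, T.IsStandard → IsUnit (g T)) : Function.Bijective (twist g) := by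
  classical
  have hinv : ∀ T : StdTableau lam, g T.1 * Ring.inverse (g T.1) = 1 ∧
      Ring.inverse (g T.1) * g T.1 = 1 := fun T =>
    ⟨Ring.mul_inverse_cancel _ (hg _ T.2), Ring.inverse_mul_cancel _ (hg _ T.2)⟩
  refine Function.bijective_iff_has_inverse.2 ⟨twist fun T => Ring.inverse (g T), fun x => ?_,
    fun x => ?_⟩
  · induction x using Finsupp.induction_linear with
    | zero => simp
    | add x y hx hy => simp only [map_add, hx, hy]
    | single T u => rw [twist_single, twist_single, ← Module.End.mul_apply, (hinv T).2]; rfl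
  · induction x using Finsupp.induction_linear with
    | zero => simp
    | add x y hx hy => simp only [map_add, hx, hy]
    | single T u => rw [twist_single, twist_single, ← Module.End.mul_apply, (hinv T).1]; rfl

variable [NeZero m]

/-- In the scalar model `σ_i + α` becomes `q + α`, precisely the denominator of `bax`; gauge
compatibility is therefore the intertwining condition. -/
theorem exists_tabRep_equiv_trivRep (ρ : Hecke n q v →ₐ[ℂ] Module.End ℂ U) (hg : Generic n q v)
    (lam : MPartition m n) :
    ∃ Θ : (StdTableau lam →₀ U) ≃ₗ[ℂ] (StdTableau lam →₀ U), ∀ x w,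
      Θ (tabRep (trivRep hg.q_ne_zero U) hg lam x w) = tabRep ρ hg lam x (Θ w) := by
  obtain ⟨g, hgauge⟩ := exists_isGauge ρ hg lam
  refine ⟨LinearEquiv.ofBijective (twist g) (twist_bijective hgauge.isUnit),
    intertwine (tabRep (trivRep hg.q_ne_zero U) hg lam) (tabRep ρ hg lam) (twist g) ?_ ?_⟩
  · intro h w
    simp only [tabRep_tau]
    induction w using Finsupp.induction_linear with
    | zero => simp
    | add x y hx hy => simp only [map_add, hx, hy]
    | single T u => rw [tabTau_single, map_smul, twist_single, tabTau_single]
  · intro i h w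
    simp only [tabRep_sigma]
    induction w using Finsupp.induction_linear with
    | zero => simp
    | add x y hx hy => simp only [map_add, hx, hy]
    | single T u =>
      rw [tabSigma_single, map_sub, map_smul, twist_single, twist_ket, tabSigma_single,
        repSigma_trivRep]
      congr 1
      by_cases hs : (T.1.sw i h).IsStandard
      · rw [hgauge.flat T.1 i h h.le T.2 hs, ← add_smul, map_smul, fillBax, bax,
          Module.End.mul_apply, LinearMap.smul_apply, smul_smul, mul_inv_cancel₀, one_smul]
        · rfl
        · exact add_alpha_ne_zero hg.q_ne_zero
            (T.2.cont_ne hg ⟨i, by omega⟩ ⟨i + 1, h⟩ (by simp [Fin.lt_def]) (by simp))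
            (cut_eq_one hg T.2 i h hs)
      · rw [ket_of_not_std hs, ket_of_not_std hs]

omit [NeZero m] in
theorem mapRange_ket {W : Type*} [AddCommGroup W] [Module ℂ W] (f : U →ₗ[ℂ] W) (F : Filling lam)
    (u : U) : Finsupp.mapRange.linearMap f (ket U F u) = ket W F (f u) := by
  by_cases h : F.IsStandard
  · obtain ⟨T, rfl⟩ : ∃ T : StdTableau lam, T.1 = F := ⟨⟨F, h⟩, rfl⟩
    rw [ket_std, ket_std, Finsupp.mapRange.linearMap_apply, Finsupp.mapRange_single]
  · rw [ket_of_not_std h, ket_of_not_std h, map_zero]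

/-- Every linear map commutes with scalars, so coordinates on `U` split the scalar model into
equivariant copies. -/
theorem mapRange_tabRep_trivRep {W : Type*} [AddCommGroup W] [Module ℂ W] (f : U →ₗ[ℂ] W)
    (hg : Generic n q v) (x : Hecke n q v) (w : StdTableau lam →₀ U) :
    Finsupp.mapRange.linearMap f (tabRep (trivRep hg.q_ne_zero U) hg lam x w) =
      tabRep (trivRep hg.q_ne_zero W) hg lam x (Finsupp.mapRange.linearMap f w) := by
  have hs : ∀ (T : StdTableau lam) (u : U), Finsupp.mapRange.linearMap f (Finsupp.single T u) =
      Finsupp.single T (f u) := fun T u => by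
    rw [Finsupp.mapRange.linearMap_apply, Finsupp.mapRange_single]
  refine intertwine _ _ _ ?_ ?_ x w
  · intro h w
    simp only [tabRep_tau]
    induction w using Finsupp.induction_linear with
    | zero => simp
    | add x y hx hy => simp only [map_add, hx, hy]
    | single T u => rw [tabTau_single, map_smul, hs, tabTau_single]
  · intro i h w
    simp only [tabRep_sigma]
    induction w using Finsupp.induction_linear with
    | zero => simp
    | add x y hx hy => simp only [map_add, hx, hy]
    | single T u =>
      rw [tabSigma_single, map_sub, map_smul, hs, mapRange_ket, tabSigma_single]
      simp only [repSigma_trivRep, map_add, map_smul]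

theorem exists_tabRep_equiv_pi {X : Type*} [Finite X]
    (ρ : Hecke n q v →ₐ[ℂ] Module.End ℂ (X →₀ ℂ)) (hg : Generic n q v) (lam : MPartition m n) :
    ∃ Φ : (StdTableau lam →₀ (X →₀ ℂ)) ≃ₗ[ℂ] (X → (StdTableau lam →₀ ℂ)), ∀ x w s,
      Φ (tabRep ρ hg lam x w) s = tabRep (trivRep hg.q_ne_zero ℂ) hg lam x (Φ w s) := by
  classical
  obtain ⟨Θ, hΘ⟩ := exists_tabRep_equiv_trivRep ρ hg lam
  cases nonempty_fintype X
  let f : (StdTableau lam →₀ (X →₀ ℂ)) →ₗ[ℂ] (X → (StdTableau lam →₀ ℂ)) :=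
    LinearMap.pi fun s => Finsupp.mapRange.linearMap (Finsupp.lapply s)
  have hf : ∀ w s T, f w s T = w T s := fun w s T => rfl
  have hbij : Function.Bijective f := by
    refine ⟨fun w w' h => ?_, fun y =>
      ⟨∑ s, Finsupp.mapRange.linearMap (Finsupp.lsingle (R := ℂ) (M := ℂ) s) (y s),
      ?_⟩⟩
    · ext T s
      rw [← hf, h, hf]
    · ext s T
      rw [hf, Finsupp.finsetSum_apply, Finsupp.finsetSum_apply]
      simp [Finsupp.single_apply]
  refine ⟨Θ.symm.trans (LinearEquiv.ofBijective f hbij), fun x w s => ?_⟩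
  obtain ⟨w, rfl⟩ := Θ.surjective w
  rw [← hΘ, LinearEquiv.trans_apply, LinearEquiv.trans_apply, Θ.symm_apply_apply,
    Θ.symm_apply_apply]
  exact mapRange_tabRep_trivRep (Finsupp.lapply s) hg x w

end GaugeEquiv

/-! ### A representation of the smash product that separates words of length one and two. -/

section SmashRep

set_option maxSynthPendingDepth 3

variable {q : ℂ} {v : Fin m → ℂ}

open Classical in
/-- The map `ket` of a filling of any shape, which is zero for shapes other than `lam`. -/
def ketOf (lam : MPartition m n) (U : Type*) [AddCommGroup U] [Module ℂ U] {nu : MPartition m n}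
    (F : Filling nu) : U →ₗ[ℂ] (StdTableau lam →₀ U) :=
  if h : nu = lam then ket U (h ▸ F) else 0

theorem ketOf_self {lam : MPartition m n} {U : Type*} [AddCommGroup U] [Module ℂ U]
    (F : Filling lam) : ketOf lam U F = ket U F := by
  rw [ketOf, dif_pos rfl]

theorem ketOf_of_not_std (lam : MPartition m n) {U : Type*} [AddCommGroup U] [Module ℂ U]
    {nu : MPartition m n} {F : Filling nu} (hF : ¬ F.IsStandard) : ketOf lam U F = 0 := by
  rw [ketOf]
  split_ifs with h
  · subst h
    exact LinearMap.ext fun u => ket_of_not_std hF u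
  · rfl

section

variable {U : Type*} [AddCommGroup U] [Module ℂ U] (ρ : Hecke n q v →ₐ[ℂ] Module.End ℂ U)
  (hg : Generic n q v) (lam : MPartition m n) {nu : MPartition m n} (T : StdTableau nu) (u : U)

theorem tabRep_sigma_ketOf (i : ℕ) (h : i + 1 < n) :
    tabRep ρ hg lam (Hecke.sigma q v i h) (ketOf lam U T.1 u) =
      ketOf lam U (T.1.sw i h) (ρ (Hecke.sigma q v i h) u +
        alpha q ((T.1 ⟨i + 1, h⟩).cont q v) ((T.1 ⟨i, by omega⟩).cont q v) • u) -
      alpha q ((T.1 ⟨i, by omega⟩).cont q v) ((T.1 ⟨i + 1, h⟩).cont q v) •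
        ketOf lam U T.1 u := by
  by_cases hn : nu = lam
  · subst hn
    rw [ketOf_self, ketOf_self, ket_std, tabRep_sigma, tabSigma_single]
    rfl
  · simp [ketOf, hn]

theorem tabRep_tau_ketOf (h : 0 < n) :
    tabRep ρ hg lam (Hecke.tau q v h) (ketOf lam U T.1 u) =
      (T.1 ⟨0, h⟩).cont q v • ketOf lam U T.1 u := by
  by_cases hn : nu = lam
  · subst hn
    rw [ketOf_self, ket_std, tabRep_tau, tabTau_single]
  · simp [ketOf, hn]

end

variable [NeZero m] (hg : Generic n q v) (lam mu : MPartition m n)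

/-- The representation on functions on the standard tableaux of shape `mu`. -/
def rep₁ : Hecke n q v →ₐ[ℂ] Module.End ℂ (StdTableau mu →₀ ℂ) :=
  tabRep (trivRep hg.q_ne_zero ℂ) hg mu

/-- The representation on functions on pairs of standard tableaux of shapes `lam` and `mu`. -/
def rep₂ : Hecke n q v →ₐ[ℂ] Module.End ℂ (StdTableau lam →₀ (StdTableau mu →₀ ℂ)) :=
  tabRep (rep₁ hg mu) hg lam

/-- The space on which words of length at most two in the tableau generators act faithfully
enough. -/
abbrev WordSpace (lam mu : MPartition m n) : Type :=
  ℂ × (StdTableau mu →₀ ℂ) × (StdTableau lam →₀ (StdTableau mu →₀ ℂ))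

/-- The action of the Hecke algebra on the word space. -/
def wordRep : Hecke n q v →ₐ[ℂ] Module.End ℂ (WordSpace lam mu) :=
  (LinearMap.prodMapAlgHom ℂ _ _).comp ((trivRep hg.q_ne_zero ℂ).prod
    ((LinearMap.prodMapAlgHom ℂ _ _).comp ((rep₁ hg mu).prod (rep₂ hg lam mu))))

theorem wordRep_apply (x : Hecke n q v) (p : WordSpace lam mu) :
    wordRep hg lam mu x p =
      (trivChar hg.q_ne_zero x * p.1, rep₁ hg mu x p.2.1, rep₂ hg lam mu x p.2.2) := rfl

/-- The action of a filling on the word space. -/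
def wordX {nu : MPartition m n} (F : Filling nu) : Module.End ℂ (WordSpace lam mu) :=
  LinearMap.prod 0 (LinearMap.prod (ketOf mu ℂ F ∘ₗ LinearMap.fst ℂ _ _)
    (ketOf lam _ F ∘ₗ LinearMap.fst ℂ _ _ ∘ₗ LinearMap.snd ℂ _ _))

omit [NeZero m] in
theorem wordX_apply {nu : MPartition m n} (F : Filling nu) (p : WordSpace lam mu) :
    wordX lam mu F p = (0, ketOf mu ℂ F p.1, ketOf lam _ F p.2.1) := rfl

/-- The action of the generators of the smash product on the word space. -/
def wordGen : SGen m n → Module.End ℂ (WordSpace lam mu) :=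
  Sum.elim (fun g => wordRep hg lam mu (RingQuot.mkAlgHom ℂ _ (FreeAlgebra.ι ℂ g)))
    fun T => wordX lam mu T.2.1

theorem lift_wordGen_inclH (a : FreeAlgebra ℂ (HGen n)) :
    FreeAlgebra.lift ℂ (wordGen hg lam mu) (inclH m n a) =
      wordRep hg lam mu (RingQuot.mkAlgHom ℂ _ a) := by
  have : (FreeAlgebra.lift ℂ (wordGen hg lam mu)).comp (inclH m n) =
      (wordRep hg lam mu).comp (RingQuot.mkAlgHom ℂ _) := by
    ext g : 2
    simp only [inclH, AlgHom.coe_comp, Function.comp_apply, FreeAlgebra.lift_ι_apply, wordGen,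
      Sum.elim_inl]
  exact DFunLike.congr_fun this a

theorem lift_wordGen_fX {nu : MPartition m n} (F : Filling nu) :
    FreeAlgebra.lift ℂ (wordGen hg lam mu) (fX F) = wordX lam mu F := by
  rw [fX]
  split_ifs with h
  · rw [FreeAlgebra.lift_ι_apply]
    rfl
  · rw [map_zero, wordX, ketOf_of_not_std mu h, ketOf_of_not_std lam h]
    rfl

/-- Tableau generators raise the degree by one and are zero on the top degree; in each of the two
raising steps the mixed relations are the defining formulas of `tabRep`. -/
theorem wordGen_rel {a b : FreeAlgebra ℂ (SGen m n)} (h : SmashRel n q v a b) :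
    FreeAlgebra.lift ℂ (wordGen hg lam mu) a = FreeAlgebra.lift ℂ (wordGen hg lam mu) b := by
  cases h with
  | hecke h => rw [lift_wordGen_inclH, lift_wordGen_inclH, RingQuot.mkAlgHom_rel ℂ h]
  | sigma_X nu T i h h' =>
    simp only [map_mul, map_add, lift_wordGen_inclH, lift_wordGen_fX, AlgHom.commutes]
    refine LinearMap.ext fun p => ?_
    simp only [Module.End.mul_apply, LinearMap.add_apply, Module.algebraMap_end_apply]
    rw [show RingQuot.mkAlgHom ℂ (HeckeRel n q v) (fSigma i h) = Hecke.sigma q v i h from rfl]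
    simp only [wordX_apply, wordRep_apply, mul_zero, rep₂, tabRep_sigma_ketOf]
    have e₁ := tabRep_sigma_ketOf (trivRep hg.q_ne_zero ℂ) hg mu T p.1 i h
    rw [← rep₁] at e₁
    rw [e₁]
    refine Prod.ext (by simp) (Prod.ext ?_ ?_)
    · exact (sub_add_cancel _ _ : (_ : StdTableau mu →₀ ℂ) - _ + _ = _)
    · exact (sub_add_cancel _ _ : (_ : StdTableau lam →₀ (StdTableau mu →₀ ℂ)) - _ + _ = _)
  | tau_X nu T h =>
    rw [map_mul, map_sub, lift_wordGen_inclH, lift_wordGen_fX, AlgHom.commutes, map_zero]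
    refine LinearMap.ext fun p => ?_
    simp only [Module.End.mul_apply, LinearMap.sub_apply, Module.algebraMap_end_apply]
    rw [show RingQuot.mkAlgHom ℂ (HeckeRel n q v) (fTau h) = Hecke.tau q v h from rfl]
    simp only [wordX_apply, wordRep_apply, mul_zero, rep₂, tabRep_tau_ketOf]
    have e₁ := tabRep_tau_ketOf (trivRep hg.q_ne_zero ℂ) hg mu T p.1 h
    rw [← rep₁] at e₁
    rw [e₁]
    refine Prod.ext (by simp) (Prod.ext ?_ ?_)
    · exact (sub_self _ : (_ : StdTableau mu →₀ ℂ) - _ = 0)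
    · exact (sub_self _ : (_ : StdTableau lam →₀ (StdTableau mu →₀ ℂ)) - _ = 0)

/-- The action of the smash product on the word space. -/
def smashRep : Smash n q v →ₐ[ℂ] Module.End ℂ (WordSpace lam mu) :=
  RingQuot.liftAlgHom ℂ ⟨FreeAlgebra.lift ℂ (wordGen hg lam mu),
    fun _ _ h => wordGen_rel hg lam mu h⟩

theorem smashRep_mk (a : FreeAlgebra ℂ (SGen m n)) :
    smashRep hg lam mu (RingQuot.mkAlgHom ℂ _ a) = FreeAlgebra.lift ℂ (wordGen hg lam mu) a :=
  RingQuot.liftAlgHom_mkAlgHom_apply _ _ _ _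

omit [NeZero m] in
theorem heckeToSmash_mk (a : FreeAlgebra ℂ (HGen n)) :
    heckeToSmash q v n (RingQuot.mkAlgHom ℂ _ a) = RingQuot.mkAlgHom ℂ _ (inclH m n a) :=
  RingQuot.liftAlgHom_mkAlgHom_apply _ _ _ _

theorem smashRep_heckeToSmash (x : Hecke n q v) :
    smashRep hg lam mu (heckeToSmash q v n x) = wordRep hg lam mu x := by
  obtain ⟨a, rfl⟩ := RingQuot.mkAlgHom_surjective ℂ (HeckeRel n q v) x
  rw [heckeToSmash_mk, smashRep_mk, lift_wordGen_inclH]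

theorem smashRep_sX {nu : MPartition m n} (T : StdTableau nu) :
    smashRep hg lam mu (sX q v T) = wordX lam mu T.1 := by
  rw [sX, smashRep_mk, lift_wordGen_fX]

omit [NeZero m] in
theorem heckeToSmash_sigma (i : ℕ) (h : i + 1 < n) :
    heckeToSmash q v n (Hecke.sigma q v i h) = sSigma q v i h :=
  RingQuot.liftAlgHom_mkAlgHom_apply _ _ _ _

omit [NeZero m] in
theorem heckeToSmash_tau (h : 0 < n) :
    heckeToSmash q v n (Hecke.tau q v h) = sTau q v h :=
  RingQuot.liftAlgHom_mkAlgHom_apply _ _ _ _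

/-- A representation of the smash product with a vector on which the Hecke algebra acts by the
vacuum character receives a map from the vacuum module. -/
theorem exists_vacuumModule_map {P : Type*} [AddCommGroup P] [Module ℂ P]
    (φ : Smash n q v →ₐ[ℂ] Module.End ℂ P) (p₀ : P) (hτ : ∀ h, φ (sTau q v h) p₀ = v 0 • p₀)
    (hσ : ∀ i h, φ (sSigma q v i h) p₀ = q • p₀) :
    ∃ f : VacuumModule q v n →ₗ[ℂ] P, f (vacuum q v n) = p₀ ∧ ∀ x w, f (x • w) = φ x (f w) := by
  let _ : Module (Smash n q v) P := Module.compHom P φ.toRingHom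
  have hsm : ∀ (x : Smash n q v) (p : P), x • p = φ x p := fun _ _ => rfl
  have hle : vacuumIdeal q v n ≤ LinearMap.ker (LinearMap.toSpanSingleton (Smash n q v) P p₀) := by
    refine Submodule.span_le.2 ?_
    rintro x (⟨h, rfl⟩ | ⟨i, h, rfl⟩)
    · simp [LinearMap.mem_ker, hsm, hτ]
    · simp [LinearMap.mem_ker, hsm, hσ]
  let g : VacuumModule q v n →ₗ[Smash n q v] P := (vacuumIdeal q v n).liftQ _ hle
  refine ⟨{ toFun := g, map_add' := g.map_add, map_smul' := fun c w => ?_ }, ?_, fun x w => ?_⟩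
  · change g (algebraMap ℂ (Smash n q v) c • w) = c • g w
    rw [map_smul, hsm, AlgHom.commutes, Module.algebraMap_end_apply]
  · change (1 : Smash n q v) • p₀ = p₀
    rw [one_smul]
  · exact g.map_smul x w

theorem exists_vec_maps : ∃ (f₁ : VacuumModule q v n →ₗ[ℂ] (StdTableau mu →₀ ℂ))
    (f₂ : VacuumModule q v n →ₗ[ℂ] (StdTableau lam →₀ (StdTableau mu →₀ ℂ))),
    (∀ S : StdTableau mu, f₁ (vec q v S) = Finsupp.single S 1) ∧
    (∀ (T : StdTableau lam) (S : StdTableau mu),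
      f₂ (vec₂ q v T S) = Finsupp.single T (Finsupp.single S 1)) ∧
    (∀ (x : Hecke n q v) w, f₁ (x • w) = rep₁ hg mu x (f₁ w)) ∧
    ∀ (x : Hecke n q v) w, f₂ (x • w) = rep₂ hg lam mu x (f₂ w) := by
  obtain ⟨f, h0, hf⟩ := exists_vacuumModule_map (smashRep hg lam mu)
    ((1, 0, 0) : WordSpace lam mu)
    (fun h => by
      rw [← heckeToSmash_tau, smashRep_heckeToSmash, wordRep_apply, trivChar_tau]
      simp)
    (fun i h => by
      rw [← heckeToSmash_sigma, smashRep_heckeToSmash, wordRep_apply, trivChar_sigma]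
      simp)
  have hH : ∀ (x : Hecke n q v) w, f (x • w) = wordRep hg lam mu x (f w) := fun x w => by
    rw [← smashRep_heckeToSmash]
    exact hf _ w
  have hv : ∀ S : StdTableau mu, (f (vec q v S)).2.1 = Finsupp.single S 1 := fun S => by
    rw [vec, hf, h0, smashRep_sX, wordX_apply, ketOf_self, ket_std]
  refine ⟨LinearMap.fst ℂ _ _ ∘ₗ LinearMap.snd ℂ _ _ ∘ₗ f,
    LinearMap.snd ℂ _ _ ∘ₗ LinearMap.snd ℂ _ _ ∘ₗ f, hv, fun T S => ?_, fun x w => ?_,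
    fun x w => ?_⟩
  · change (f (vec₂ q v T S)).2.2 = _
    rw [vec₂, mul_smul, hf, smashRep_sX, wordX_apply, ketOf_self, ket_std]
    exact congrArg (Finsupp.single T) (hv S)
  · change (f (x • w)).2.1 = _
    rw [hH, wordRep_apply]
    rfl
  · change (f (x • w)).2.2 = _
    rw [hH, wordRep_apply]
    rfl

end SmashRep

/-! ### Spanning by moving the Hecke generators to the right. -/

section Span

variable {q : ℂ} {v : Fin m → ℂ} [NeZero m]

/-- A subspace of the vacuum module stable under the Hecke algebra. -/
def HStable (N : Submodule ℂ (VacuumModule q v n)) : Prop :=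
  ∀ (x : Hecke n q v) (w : VacuumModule q v n), w ∈ N → x • w ∈ N

theorem hStable_of_generators {N : Submodule ℂ (VacuumModule q v n)}
    (hτ : ∀ h : 0 < n, ∀ w ∈ N, sTau q v h • w ∈ N)
    (hσ : ∀ (i : ℕ) (h : i + 1 < n), ∀ w ∈ N, sSigma q v i h • w ∈ N) :
    HStable N := by
  intro x
  induction x using Hecke.induction_on with
  | algebraMap c =>
    intro w hw
    rw [algebraMap_smul]
    exact N.smul_mem c hw
  | tau h =>
    intro w hw
    change heckeToSmash q v n _ • w ∈ N
    rw [heckeToSmash_tau]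
    exact hτ h w hw
  | sigma i h =>
    intro w hw
    change heckeToSmash q v n _ • w ∈ N
    rw [heckeToSmash_sigma]
    exact hσ i h w hw
  | mul a b ha hb =>
    intro w hw
    rw [mul_smul]
    exact ha _ (hb _ hw)
  | add a b ha hb =>
    intro w hw
    rw [add_smul]
    exact N.add_mem (ha _ hw) (hb _ hw)

theorem HStable.sSigma_smul {N : Submodule ℂ (VacuumModule q v n)} (hN : HStable N) (i : ℕ)
    (h : i + 1 < n) {w : VacuumModule q v n} (hw : w ∈ N) : sSigma q v i h • w ∈ N := by
  rw [← heckeToSmash_sigma]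
  exact hN _ w hw

theorem smul_smul_comm (c : ℂ) (x : Smash n q v) (w : VacuumModule q v n) :
    x • c • w = c • x • w := by
  change x • algebraMap ℂ (Smash n q v) c • w = algebraMap ℂ (Smash n q v) c • x • w
  rw [← mul_smul, ← mul_smul, Algebra.commutes]

theorem algebraMap_smash_smul (c : ℂ) (w : VacuumModule q v n) :
    algebraMap ℂ (Smash n q v) c • w = c • w := rfl

/-- An element of the smash product, as a linear operator on the vacuum module. -/
def smashOp (x : Smash n q v) : Module.End ℂ (VacuumModule q v n) where
  toFun w := x • w
  map_add' := smul_add x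
  map_smul' c w := smul_smul_comm c x w

theorem sSigma_sX_smul {lam : MPartition m n} (T : StdTableau lam) (i : ℕ) (h : i + 1 < n)
    (w : VacuumModule q v n) :
    sSigma q v i h • sX q v T • w =
      RingQuot.mkAlgHom ℂ (SmashRel n q v) (fX (T.1.sw i h)) • (sSigma q v i h • w +
        alpha q ((T.1 ⟨i + 1, h⟩).cont q v) ((T.1 ⟨i, by omega⟩).cont q v) • w) -
      alpha q ((T.1 ⟨i, by omega⟩).cont q v) ((T.1 ⟨i + 1, h⟩).cont q v) • sX q v T • w := by
  have := RingQuot.mkAlgHom_rel ℂ (SmashRel.sigma_X (q := q) (v := v) lam T i h (by omega))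
  simp only [map_mul, map_add, AlgHom.commutes] at this
  have h2 := congr($this • w)
  simp only [mul_smul, add_smul, algebraMap_smash_smul] at h2
  exact eq_sub_of_add_eq h2

theorem sTau_sX_smul {lam : MPartition m n} (T : StdTableau lam) (h : 0 < n)
    (w : VacuumModule q v n) :
    sTau q v h • sX q v T • w = (T.1 ⟨0, h⟩).cont q v • sX q v T • w := by
  have := RingQuot.mkAlgHom_rel ℂ (SmashRel.tau_X (q := q) (v := v) lam T h)
  rw [map_mul, map_sub, AlgHom.commutes, map_zero] at this
  have h2 := congr($this • w)
  rw [mul_smul, sub_smul, zero_smul, algebraMap_smash_smul] at h2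
  exact sub_eq_zero.1 h2

/-- After `σ` passes a tableau generator, the generators that appear have the same shape and the
vectors to their right stay in the stable span of `w`; a nonstandard exchange contributes zero. -/
theorem HStable.sX_span {lam : MPartition m n} {ι : Type*} {w : ι → VacuumModule q v n}
    (hw : HStable (Submodule.span ℂ (Set.range w))) :
    HStable (Submodule.span ℂ
      (Set.range fun p : StdTableau lam × ι => sX q v p.1 • w p.2)) := by
  set N := Submodule.span ℂ (Set.range fun p : StdTableau lam × ι => sX q v p.1 • w p.2) with hN
  have mem : ∀ (T : StdTableau lam) y, y ∈ Submodule.span ℂ (Set.range w) → sX q v T • y ∈ N := by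
    intro T y hy
    refine (Submodule.span_le (p := N.comap (smashOp (sX q v T)))).2 ?_ hy
    rintro _ ⟨j, rfl⟩
    exact Submodule.subset_span ⟨(T, j), rfl⟩
  have mem' : ∀ (F : Filling lam) y, y ∈ Submodule.span ℂ (Set.range w) →
      RingQuot.mkAlgHom ℂ (SmashRel n q v) (fX F) • y ∈ N := by
    intro F y hy
    by_cases hF : F.IsStandard
    · exact mem ⟨F, hF⟩ y hy
    · rw [fX, dif_neg hF, map_zero, zero_smul]
      exact N.zero_mem
  refine hStable_of_generators (fun h y hy => ?_) (fun i h y hy => ?_)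
  · refine (Submodule.span_le (p := N.comap (smashOp (sTau q v h)))).2 ?_ hy
    rintro _ ⟨⟨T, j⟩, rfl⟩
    change sTau q v h • sX q v T • w j ∈ N
    rw [sTau_sX_smul]
    exact N.smul_mem _ (mem T _ (Submodule.subset_span ⟨j, rfl⟩))
  · refine (Submodule.span_le (p := N.comap (smashOp (sSigma q v i h)))).2 ?_ hy
    rintro _ ⟨⟨T, j⟩, rfl⟩
    change sSigma q v i h • sX q v T • w j ∈ N
    have hj : w j ∈ Submodule.span ℂ (Set.range w) := Submodule.subset_span ⟨j, rfl⟩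
    rw [sSigma_sX_smul]
    exact N.sub_mem (mem' _ _ (Submodule.add_mem _ (hw.sSigma_smul i h hj)
      (Submodule.smul_mem _ _ hj))) (N.smul_mem _ (mem T _ hj))

theorem sTau_vacuum (h : 0 < n) : sTau q v h • vacuum q v n = v 0 • vacuum q v n := by
  rw [← sub_eq_zero, ← algebraMap_smash_smul, ← sub_smul]
  change Submodule.Quotient.mk (p := vacuumIdeal q v n) (_ * (1 : Smash n q v)) = 0
  rw [mul_one, Submodule.Quotient.mk_eq_zero]
  exact Submodule.subset_span (Or.inl ⟨h, rfl⟩)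

theorem sSigma_vacuum (i : ℕ) (h : i + 1 < n) :
    sSigma q v i h • vacuum q v n = q • vacuum q v n := by
  rw [← sub_eq_zero, ← algebraMap_smash_smul, ← sub_smul]
  change Submodule.Quotient.mk (p := vacuumIdeal q v n) (_ * (1 : Smash n q v)) = 0
  rw [mul_one, Submodule.Quotient.mk_eq_zero]
  exact Submodule.subset_span (Or.inr ⟨i, h, rfl⟩)

theorem hStable_vacuum :
    HStable (Submodule.span ℂ (Set.range fun _ : Unit => vacuum q v n)) := by
  rw [Set.range_const]
  refine hStable_of_generators (fun h w hw => ?_) (fun i h w hw => ?_)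
  · obtain ⟨c, rfl⟩ := Submodule.mem_span_singleton.1 hw
    rw [smul_smul_comm, sTau_vacuum]
    exact Submodule.smul_mem _ _ (Submodule.smul_mem _ _ (Submodule.mem_span_singleton_self _))
  · obtain ⟨c, rfl⟩ := Submodule.mem_span_singleton.1 hw
    rw [smul_smul_comm, sSigma_vacuum]
    exact Submodule.smul_mem _ _ (Submodule.smul_mem _ _ (Submodule.mem_span_singleton_self _))

theorem hStable_vec (mu : MPartition m n) :
    HStable (Submodule.span ℂ (Set.range fun S : StdTableau mu => vec q v S)) := by
  have := hStable_vacuum.sX_span (q := q) (v := v) (lam := mu)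
  rwa [show (Set.range fun p : StdTableau mu × Unit => sX q v p.1 • vacuum q v n) =
    Set.range fun S : StdTableau mu => vec q v S from
      (Equiv.prodPUnit _).symm.surjective.range_comp _ |>.symm] at this

theorem hStable_vec₂ (lam mu : MPartition m n) :
    HStable (Submodule.span ℂ
      (Set.range fun p : StdTableau lam × StdTableau mu => vec₂ q v p.1 p.2)) := by
  simpa only [vec₂, vec, mul_smul] using (hStable_vec mu).sX_span (q := q) (v := v) (lam := lam)

/-- A linearly independent family with stable span is a basis of the submodule it generates. -/
theorem exists_basis_span {ι : Type*} {w : ι → VacuumModule q v n} (hli : LinearIndependent ℂ w)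
    (hw : HStable (Submodule.span ℂ (Set.range w))) :
    ∃ b : Module.Basis ι ℂ (Submodule.span (Hecke n q v) (Set.range w)),
      ∀ i, (b i : VacuumModule q v n) = w i := by
  have hle : ∀ x ∈ Submodule.span (Hecke n q v) (Set.range w),
      x ∈ Submodule.span ℂ (Set.range w) := by
    intro x hx
    induction hx using Submodule.span_induction with
    | mem x hx => exact Submodule.subset_span hx
    | zero => exact Submodule.zero_mem _
    | add x y _ _ hx hy => exact Submodule.add_mem _ hx hy
    | smul a x _ hx => exact hw a x hx
  have hge : ∀ x ∈ Submodule.span ℂ (Set.range w),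
      x ∈ Submodule.span (Hecke n q v) (Set.range w) := fun x hx =>
    Submodule.span_le_restrictScalars ℂ (Hecke n q v) _ hx
  let e : Submodule.span ℂ (Set.range w) ≃ₗ[ℂ] Submodule.span (Hecke n q v) (Set.range w) :=
    { toFun := fun x => ⟨x.1, hge x.1 x.2⟩
      invFun := fun x => ⟨x.1, hle x.1 x.2⟩
      map_add' := fun _ _ => rfl
      map_smul' := fun _ _ => rfl
      left_inv := fun _ => rfl
      right_inv := fun _ => rfl }
  refine ⟨(Module.Basis.span hli).map e, fun i => ?_⟩
  rw [Module.Basis.map_apply]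
  exact congrArg Subtype.val (Module.Basis.span_apply hli i)

end Span

instance (lam : MPartition m n) : Finite (StdTableau lam) := by
  have : Finite lam.Node := by
    have : Finite {x : Fin m × ℕ × ℕ // x.2 ∈ lam.diag x.1} := by
      refine Finite.of_injective (β := Σ k : Fin m, (lam.diag k).cells)
        (fun x => ⟨x.1.1, x.1.2, x.2⟩) fun x y h => ?_
      simp only [Sigma.mk.injEq] at h
      obtain ⟨⟨k, c⟩, hx⟩ := x
      obtain ⟨⟨k', c'⟩, hy⟩ := y
      obtain ⟨h1, h2⟩ := h
      dsimp only at h1 h2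
      subst h1
      simpa using h2
    exact this
  exact inferInstanceAs (Finite {T : Filling lam // T.IsStandard})

/-! ### Bases and the decomposition. -/

section Main

set_option maxSynthPendingDepth 3

variable {q : ℂ} {v : Fin m → ℂ} [NeZero m]

theorem exists_basis_V (hg : Generic n q v) (mu : MPartition m n) :
    ∃ (b : Module.Basis (StdTableau mu) ℂ (V q v mu))
      (e : V q v mu ≃ₗ[ℂ] (StdTableau mu →₀ ℂ)), (∀ S, (b S : VacuumModule q v n) = vec q v S) ∧
      ∀ (x : Hecke n q v) w, e (x • w) = rep₁ hg mu x (e w) := by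
  obtain ⟨f, -, h1, -, h2, -⟩ := exists_vec_maps hg mu mu
  have hli : LinearIndependent ℂ fun S : StdTableau mu => vec q v S := by
    refine LinearIndependent.of_comp f ?_
    rw [show f ∘ (fun S : StdTableau mu => vec q v S) =
      Finsupp.basisSingleOne from funext fun S =>
        (h1 S).trans (congrFun Finsupp.coe_basisSingleOne S).symm]
    exact Module.Basis.linearIndependent _
  obtain ⟨b, hb⟩ := exists_basis_span hli (hStable_vec mu)
  let e : V q v mu ≃ₗ[ℂ] (StdTableau mu →₀ ℂ) := b.repr
  -- The coordinate map coincides with the restriction of the map to the model, and so inherits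
  -- equivariance.
  have he : ∀ w, e w = f w := by
    let f' : V q v mu →ₗ[ℂ] (StdTableau mu →₀ ℂ) :=
      { toFun := fun w => f w, map_add' := fun _ _ => f.map_add _ _,
        map_smul' := fun _ _ => f.map_smul _ _ }
    have : e.toLinearMap = f' := b.ext fun S => by
      change b.repr (b S) = f (b S : VacuumModule q v n)
      rw [b.repr_self, hb, h1]
    exact fun w => LinearMap.congr_fun this w
  exact ⟨b, e, hb, fun x w => by rw [he, he]; exact h2 x w⟩

theorem exists_basis_VTensor (hg : Generic n q v) (lam mu : MPartition m n) :
    ∃ (b : Module.Basis (StdTableau lam × StdTableau mu) ℂ (VTensor q v lam mu))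
      (e : VTensor q v lam mu ≃ₗ[ℂ] (StdTableau lam →₀ (StdTableau mu →₀ ℂ))),
      (∀ T S, (b (T, S) : VacuumModule q v n) = vec₂ q v T S) ∧
      ∀ (x : Hecke n q v) w, e (x • w) = rep₂ hg lam mu x (e w) := by
  obtain ⟨-, f, -, h1, -, h2⟩ := exists_vec_maps hg lam mu
  let c : (StdTableau lam × StdTableau mu →₀ ℂ) ≃ₗ[ℂ] (StdTableau lam →₀ (StdTableau mu →₀ ℂ)) :=
    Finsupp.curryLinearEquiv ℂ
  have hc : ∀ T S, c (Finsupp.single (T, S) 1) = Finsupp.single T (Finsupp.single S 1) :=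
    fun T S => Finsupp.curry_single _ _
  have hli : LinearIndependent ℂ
      fun p : StdTableau lam × StdTableau mu => vec₂ q v p.1 p.2 := by
    refine LinearIndependent.of_comp f ?_
    rw [show f ∘ (fun p : StdTableau lam × StdTableau mu => vec₂ q v p.1 p.2) =
      Finsupp.basisSingleOne.map c from funext fun p => by
        rw [Module.Basis.map_apply, Finsupp.coe_basisSingleOne]
        exact (h1 p.1 p.2).trans (hc p.1 p.2).symm]
    exact Module.Basis.linearIndependent _
  obtain ⟨b, hb⟩ := exists_basis_span hli (hStable_vec₂ lam mu)
  let e : VTensor q v lam mu ≃ₗ[ℂ] (StdTableau lam →₀ (StdTableau mu →₀ ℂ)) := b.repr.trans c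
  have he : ∀ w, e w = f w := by
    let f' : VTensor q v lam mu →ₗ[ℂ] (StdTableau lam →₀ (StdTableau mu →₀ ℂ)) :=
      { toFun := fun w => f w, map_add' := fun _ _ => f.map_add _ _,
        map_smul' := fun _ _ => f.map_smul _ _ }
    have : e.toLinearMap = f' := b.ext fun p => by
      change c (b.repr (b p)) = f (b p : VacuumModule q v n)
      rw [b.repr_self, hb, h1]
      exact hc p.1 p.2
    exact fun w => LinearMap.congr_fun this w
  exact ⟨b, e, fun T S => hb (T, S), fun x w => by rw [he, he]; exact h2 x w⟩

theorem nonempty_VTensor_equiv (hg : Generic n q v) (lam mu : MPartition m n) :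
    Nonempty (VTensor q v lam mu ≃ₗ[Hecke n q v]
      (Fin (Module.finrank ℂ (V q v mu)) → V q v lam)) := by
  obtain ⟨b, -, -, -⟩ := exists_basis_V hg mu
  obtain ⟨-, e₁, -, h₁⟩ := exists_basis_V hg lam
  obtain ⟨-, e₂, -, h₂⟩ := exists_basis_VTensor hg lam mu
  obtain ⟨Φ, hΦ⟩ := exists_tabRep_equiv_pi (rep₁ hg mu) hg lam
  have hcard : Module.finrank ℂ (V q v mu) = Nat.card (StdTableau mu) :=
    Module.finrank_eq_nat_card_basis b
  let r : Fin (Module.finrank ℂ (V q v mu)) ≃ StdTableau mu :=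
    (finCongr hcard).trans (Finite.equivFin (StdTableau mu)).symm
  let E : VTensor q v lam mu ≃+ (Fin (Module.finrank ℂ (V q v mu)) → V q v lam) :=
    (e₂.trans Φ).toAddEquiv.trans
      { toFun := fun y i => e₁.symm (y (r i))
        invFun := fun y s => e₁ (y (r.symm s))
        left_inv := fun y => by simp
        right_inv := fun y => by simp
        map_add' := fun y z => by
          funext i
          exact e₁.symm.map_add _ _ }
  refine ⟨{ E with map_smul' := fun x w => ?_ }⟩
  funext i
  change e₁.symm (Φ (e₂ (x • w)) (r i)) = x • e₁.symm (Φ (e₂ w) (r i))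
  rw [h₂, LinearEquiv.symm_apply_eq, h₁, LinearEquiv.apply_symm_apply]
  exact hΦ x (e₂ w) (r i)

end Main

end

end CyclotomicHecke

theorem mainTheorem7 (m n : ℕ) [NeZero m] (q : ℂ) (v : Fin m → ℂ)
    (hq : q ≠ 0) (hq1 : 2 ≤ n → q ^ 2 ≠ 1)
    (h1 : ∀ N : ℕ, N < n → ∑ j ∈ Finset.range (N + 1), q ^ (2 * j) ≠ 0)
    (h2 : ∀ (i : ℤ) (j k : Fin m), j ≠ k → -(n : ℤ) < i → i < (n : ℤ) →
      q ^ (2 * i) * v j - v k ≠ 0)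
    (h3 : ∀ j : Fin m, v j ≠ 0)
    (lam mu : MPartition m n) :
    (∃ b : Module.Basis (StdTableau lam) ℂ (V q v lam),
      ∀ T : StdTableau lam, (b T : VacuumModule q v n) = vec q v T) ∧
    (∃ b : Module.Basis (StdTableau lam × StdTableau mu) ℂ (VTensor q v lam mu),
      ∀ (T : StdTableau lam) (S : StdTableau mu),
        (b (T, S) : VacuumModule q v n) = vec₂ q v T S) ∧
    Nonempty (VTensor q v lam mu ≃ₗ[Hecke n q v]
      (Fin (Module.finrank ℂ (V q v mu)) → V q v lam)) := by
  have hg : Generic n q v := ⟨hq, hq1, h1, h2, h3⟩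
  obtain ⟨b, -, hb, -⟩ := exists_basis_V hg lam
  obtain ⟨b₂, -, hb₂, -⟩ := exists_basis_VTensor hg lam mu
  exact ⟨⟨b, hb⟩, ⟨b₂, hb₂⟩, nonempty_VTensor_equiv hg lam mu⟩
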